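/- Let $d\ge 0$ be an integer. There is a constant $c>0$ depending only on $d$ such that for every $\alpha>0$ and every $\varepsilon\in(0,\tfrac14)$ there is a constant $C>0$, depending only on $d,\alpha,\varepsilon$, with the following property. Let $G=(V,\mathcal E)$ be any finite $d$-regular multigraph (loops and multiple edges allowed, a loop counting twice in the degree) on $n\ge 1$ vertices. Let $n_{xy}$ be the number of edges joining $x$ and $y$ (with loops counted twice in $n_{xx}$), let $p_{xy}=n_{xy}/d$ (with $p_{xy}=0$ if $d=0$), let $\pi$ be the uniform distribution on $V$, and assume that the spectral gap $$\lambda_G=\min\Big\{\tfrac12\sum_{x,y\in V}(f(x)-f(y))^2\pi_x p_{xy}\;:\; f:V\to\mathbb R,\ \pi(f^2)=1,\ \pi(f)=0\Big\}$$ satisfies $\lambda_G\ge\alpha$ (with $\lambda_G=+\infty$ if $n=1$). Let $(X_t)_{t\ge 0}$ be the continuous-time simple random walk on $G$, that is, the càdlàg Markov process with generator $\mathcal Lf(x)=\sum_{y}p_{xy}(f(y)-f(x))$, started from $\pi$; write $P^G$ and $E^G$ for its law and expectation. For $u\ge 0$ let $\mathcal V^u=V\setminus\{X_t:0\le t\le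 un\}$ be the vacant set, let the vacant graph $\mathbf V^u$ be the multigraph with vertex set $V$ whose edges are the edges of $G$ with all endpoints in $\mathcal V^u$, let $\mathcal D^u$ be the degree sequence of $\mathbf V^u$, and let $n_i(\mathcal D^u)$ be the number of vertices $x\in V$ with $\mathcal D^u(x)=i$. Then for every $u\ge 0$ and every $i\in\{0,\dots,d\}$, $$P^G\Big[\big|n_i(\mathcal D^u)-E^G[n_i(\mathcal D^u)]\big|\ge n^{1/2+\varepsilon}\Big]\le C\,e^{-c\,n^{\varepsilon}} .$$ -/

import Mathlib

open MeasureTheory Filter Topology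
open scoped NNReal Graph

noncomputable section

namespace Graph

variable {V β : Type*} [Fintype V]

open Classical in
/-- The number `n_{xy}` of edges connecting `x` and `y` in the multigraph `G`;
loops are counted twice in `n_{xx}`. -/
def numEdges (G : Graph V β) (x y : V) : ℕ :=
  if x = y then 2 * {e | G.IsLoopAt e x}.ncard else {e | G.IsLink e x y}.ncard

/-- The degree `d_x` of a vertex; loops are counted twice. -/
def degree (G : Graph V β) (x : V) : ℕ := ∑ y, G.numEdges x y

/-- `G` is a finite `d`-regular multigraph with vertex set the whole type `V`. -/
structure IsRegularMultigraph (G : Graph V β) (d : ℕ) : Prop where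
  vertexSet_eq : V(G) = Set.univ
  finite_edgeSet : E(G).Finite
  degree_eq : ∀ x, G.degree x = d

/-- `n_i`: the number of vertices of degree `i`. -/
def numVerticesOfDegree (G : Graph V β) (i : ℕ) : ℕ := {x : V | G.degree x = i}.ncard

/-- The transition probabilities `p_{xy} = n_{xy} / d_x` of simple random walk. -/
def transProb (G : Graph V β) (x y : V) : ℝ := (G.numEdges x y : ℝ) / (G.degree x : ℝ)

open Classical in
/-- The matrix of the generator `(L f)(x) = ∑ y, p_{xy} (f y - f x)`
of continuous-time simple random walk. -/
def generator (G : Graph V β) : Matrix V V ℝ :=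
  Matrix.of fun x y => G.transProb x y - if x = y then ∑ z, G.transProb x z else 0

open Classical in
/-- The transition function `P_x[X_t = y] = (exp (t L))_{xy}`. -/
def heatKernel (G : Graph V β) (t : ℝ≥0) (x y : V) : ℝ :=
  NormedSpace.exp ((t : ℝ) • G.generator) x y

/-- The mass of each vertex under the uniform distribution, which is the stationary distribution
of simple random walk on a regular multigraph. -/
def unif (V : Type*) [Fintype V] : ℝ := 1 / (Fintype.card V : ℝ)

/-- The Dirichlet form (with respect to the uniform distribution). -/
def dirichletForm (G : Graph V β) (f g : V → ℝ) : ℝ :=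
  1 / 2 * ∑ x, ∑ y, (f x - f y) * (g x - g y) * unif V * G.transProb x y

/-- The spectral gap `λ_G`: the least value of `D(f, f)` over `f` with `π(f²) = 1`, `π(f) = 0`.
It is an extended real so that it is `⊤` when there is no such `f` (a single vertex). -/
def spectralGap (G : Graph V β) : EReal :=
  sInf {r : EReal | ∃ f : V → ℝ, ∑ x, unif V * f x ^ 2 = 1 ∧ ∑ x, unif V * f x = 0 ∧
    r = ((G.dirichletForm f f : ℝ) : EReal)}

/-- `X` is, under `P`, a continuous-time simple random walk on `G` started from the uniform
distribution: it has càdlàg paths (with respect to the discrete topology on the state space)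
and the finite-dimensional distributions of the Markov process with generator `L`. -/
structure IsRandomWalk (G : Graph V β) {Ω : Type*} [MeasurableSpace Ω] (P : Measure Ω)
    (X : ℝ≥0 → Ω → V) : Prop where
  measurableSet_eq : ∀ t x, MeasurableSet {ω | X t ω = x}
  right_continuous : ∀ ω t, ∀ᶠ s in 𝓝[≥] t, X s ω = X t ω
  left_limits : ∀ ω t, ∃ x, ∀ᶠ s in 𝓝[<] t, X s ω = x
  finite_dim : ∀ (k : ℕ) (t : Fin (k + 1) → ℝ≥0) (x : Fin (k + 1) → V), Monotone t → t 0 = 0 →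
    P.real {ω | ∀ j, X (t j) ω = x j} =
      unif V * ∏ j : Fin k, G.heatKernel (t j.succ - t j.castSucc) (x j.castSucc) (x j.succ)

/-- The set of vertices not visited up to time `T` (inclusive) by the trajectory `w`. -/
def vacantSet (w : ℝ≥0 → V) (T : ℝ≥0) : Set V := {x | ∀ t ≤ T, w t ≠ x}

/-- The vacant graph at level `u`: the vertex set is that of `G`, the edges are those edges of `G`
all of whose ends are not visited up to time `u |V|`. -/
def vacantGraph (G : Graph V β) (w : ℝ≥0 → V) (u : ℝ≥0) : Graph V β :=
  G.restrict {e | ∀ x, G.Inc e x → x ∈ vacantSet w (u * (Fintype.card V : ℝ≥0))}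

end Graph

end

/-! The degree count is a function `φ` of the visited set, and visiting one more vertex changes it
by at most `L = d + 1`. Concentration comes from an exponential martingale argument when `u ≤
n^(ε/8)`, and from the vacant set being almost empty when `u ≥ n^(ε/8)`.

For short times, sample the walk at the multiples of `δ = T / m` and follow the conditional
expectation of `φ` of the final visited set. Moving the present position changes it by at most some
`B`: after time `τ` the spectral gap has erased the position up to `exp (-α τ) n²`, and ignoring the
vertices seen meanwhile costs about `L τ`, as the expected number of moves is at most `τ`. A step
moves with probability at most `δ`, so its conditional second moment is at most `B² δ`; the uniform
start adds `B²`. Hence the centred exponential moment is at most `exp (θ² B² (1 + T))`, uniformly in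
`m`, and right-continuity passes this to the walk (`integral_exp_le`). A Chernoff bound with `τ =
n^(ε/8)` and `θ = 2 n^(-1/2)` finishes this case.

For long times, the gap bounds the probability of avoiding `A` by `exp (-|A| α T / (2 n))`
(`integral_avoid_le`). A union bound over `k`-sets makes `k` unvisited vertices exponentially
unlikely, and the count differs from a constant by at most the number of unvisited vertices
(`tail_le_of_large_time`). -/

/-! ### Finite Markov chains that record the set of visited states -/

namespace VisitedChain

variable {V : Type*} [Fintype V]

/-- One step of the chain with transition matrix `Q`, which records its visited set. -/
def step (Q : Matrix V V ℝ) (h : Set V → V → ℝ) (S : Set V) (x : V) : ℝ :=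
  ∑ y, Q x y * h (insert y S) y

/-- The expectation of `φ` of the set visited in `m` steps, united with `S`, from `x`. -/
def expect (Q : Matrix V V ℝ) (φ : Set V → ℝ) (m : ℕ) : Set V → V → ℝ :=
  (step Q)^[m] fun S _ => φ S

theorem expect_zero (Q : Matrix V V ℝ) (φ : Set V → ℝ) (S : Set V) (x : V) :
    expect Q φ 0 S x = φ S := rfl

theorem expect_succ (Q : Matrix V V ℝ) (φ : Set V → ℝ) (m : ℕ) (S : Set V) (x : V) :
    expect Q φ (m + 1) S x = ∑ y, Q x y * expect Q φ m (insert y S) y := by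
  rw [expect, Function.iterate_succ_apply']; rfl

/-- The stochastic matrix `Q` is symmetric, leaves a state with probability at most `δ` and
contracts the functions of mean zero by the factor `ρ` in `ℓ²`. -/
structure IsContractive [DecidableEq V] (Q : Matrix V V ℝ) (δ ρ : ℝ) : Prop where
  nonneg : ∀ x y, 0 ≤ Q x y
  row_sum : ∀ x, ∑ y, Q x y = 1
  col_sum : ∀ y, ∑ x, Q x y = 1
  diag : ∀ x, 1 - δ ≤ Q x x
  rho_nonneg : 0 ≤ ρ
  contract : ∀ v : V → ℝ, ∑ x, v x = 0 → ∑ x, (Q.mulVec v x) ^ 2 ≤ ρ ^ 2 * ∑ x, v x ^ 2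

/-! ### Stability of expectations and decay of mean-zero functions. -/

section Basic

variable [DecidableEq V] {Q : Matrix V V ℝ} {δ ρ : ℝ} (hQ : IsContractive Q δ ρ)
include hQ

/-- An average of quantities that vanish at the current state is small. -/
theorem IsContractive.sum_le (x : V) {a : V → ℝ} {b : ℝ} (hx : a x = 0) (ha : ∀ y, a y ≤ b)
    (hb : 0 ≤ b) : ∑ y, Q x y * a y ≤ b * δ := by
  have h1 : ∑ y ∈ Finset.univ.erase x, Q x y = 1 - Q x x := by
    rw [← hQ.row_sum x, ← Finset.add_sum_erase _ _ (Finset.mem_univ x)]; ring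
  rw [← Finset.add_sum_erase _ _ (Finset.mem_univ x), hx, mul_zero, zero_add]
  calc ∑ y ∈ Finset.univ.erase x, Q x y * a y
      ≤ ∑ y ∈ Finset.univ.erase x, Q x y * b :=
        Finset.sum_le_sum fun y _ => mul_le_mul_of_nonneg_left (ha y) (hQ.nonneg x y)
    _ = b * (1 - Q x x) := by rw [← Finset.sum_mul, h1, mul_comm]
    _ ≤ b * δ := mul_le_mul_of_nonneg_left (by linarith [hQ.diag x]) hb

theorem IsContractive.abs_sum_sub_le (x : V) {a a' : V → ℝ} {b : ℝ} (h : ∀ y, |a y - a' y| ≤ b) :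
    |∑ y, Q x y * a y - ∑ y, Q x y * a' y| ≤ b := by
  rw [← Finset.sum_sub_distrib]
  calc |∑ y, (Q x y * a y - Q x y * a' y)| ≤ ∑ y, |Q x y * a y - Q x y * a' y| :=
        Finset.abs_sum_le_sum_abs _ _
    _ ≤ ∑ y, Q x y * b := by
        refine Finset.sum_le_sum fun y _ => ?_
        rw [← mul_sub, abs_mul, abs_of_nonneg (hQ.nonneg x y)]
        exact mul_le_mul_of_nonneg_left (h y) (hQ.nonneg x y)
    _ = b := by rw [← Finset.sum_mul, hQ.row_sum, one_mul]

/-- Both expectations average over the same future path, along which the two sets still differ only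
by `z`. -/
theorem IsContractive.abs_expect_insert_sub_le {φ : Set V → ℝ} {L : ℝ}
    (hφ : ∀ z S, |φ (insert z S) - φ S| ≤ L) (m : ℕ) (z : V) (S : Set V) (x : V) :
    |expect Q φ m (insert z S) x - expect Q φ m S x| ≤ L := by
  induction m generalizing S x with
  | zero => exact hφ z S
  | succ m ih =>
    rw [expect_succ, expect_succ]
    refine hQ.abs_sum_sub_le x fun y => ?_
    rw [Set.insert_comm]
    exact ih _ _

theorem IsContractive.abs_expect_le {φ : Set V → ℝ} {M : ℝ} (hφ : ∀ S, |φ S| ≤ M) (m : ℕ)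
    (S : Set V) (x : V) : |expect Q φ m S x| ≤ M := by
  induction m generalizing S x with
  | zero => exact hφ S
  | succ m ih =>
    rw [expect_succ]
    simpa using hQ.abs_sum_sub_le x (a := fun y => expect Q φ m (insert y S) y) (a' := fun _ => 0)
      (b := M) (by simpa using fun y => ih _ _)

theorem IsContractive.abs_mulVec_pow_sub_le {v w : V → ℝ} {b : ℝ} (h : ∀ y, |v y - w y| ≤ b)
    (s : ℕ) (x : V) : |(Q ^ s).mulVec v x - (Q ^ s).mulVec w x| ≤ b := by
  induction s generalizing x with
  | zero => simpa using h x
  | succ s ih =>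
    rw [pow_succ', ← Matrix.mulVec_mulVec, ← Matrix.mulVec_mulVec]
    exact hQ.abs_sum_sub_le x ih

/-- Not recording the states visited in the first `s` steps changes little. -/
theorem IsContractive.abs_expect_sub_mulVec_le {φ : Set V → ℝ} {L : ℝ}
    (hφ : ∀ z S, |φ (insert z S) - φ S| ≤ L) (m s : ℕ) (S : Set V) (x : V) (hx : x ∈ S) :
    |expect Q φ (m + s) S x - (Q ^ s).mulVec (expect Q φ m S) x| ≤ L * (s * δ) := by
  have hL : 0 ≤ L := (abs_nonneg _).trans (hφ x S)
  induction s generalizing S x with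
  | zero => simp
  | succ s ih =>
    have h1 : |expect Q φ (m + (s + 1)) S x -
        ∑ y, Q x y * (Q ^ s).mulVec (expect Q φ m (insert y S)) y| ≤ L * (s * δ) := by
      rw [← add_assoc, expect_succ]
      exact hQ.abs_sum_sub_le x fun y => ih _ _ (Set.mem_insert _ _)
    -- Since `x ∈ S`, forgetting the first step matters only if the chain moves, which has
    -- probability at most `δ`.
    have h2 : |∑ y, Q x y * (Q ^ s).mulVec (expect Q φ m (insert y S)) y -
        (Q ^ (s + 1)).mulVec (expect Q φ m S) x| ≤ L * δ := by
      rw [pow_succ', ← Matrix.mulVec_mulVec]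
      change |_ - ∑ y, Q x y * (Q ^ s).mulVec (expect Q φ m S) y| ≤ _
      rw [← Finset.sum_sub_distrib]
      refine (Finset.abs_sum_le_sum_abs _ _).trans ?_
      simp_rw [← mul_sub, abs_mul, abs_of_nonneg (hQ.nonneg x _)]
      refine hQ.sum_le x (by simp [Set.insert_eq_of_mem hx]) (fun y => ?_) hL
      exact hQ.abs_mulVec_pow_sub_le (fun z => hQ.abs_expect_insert_sub_le hφ m y S z) s y
    calc _ ≤ _ := abs_sub_le _ _ _
      _ ≤ L * (s * δ) + L * δ := add_le_add h1 h2
      _ = _ := by push_cast; ring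

/-- The starting point is forgotten as well, at the price of one more `L`. -/
theorem IsContractive.abs_expect_insert_sub_mulVec_le {φ : Set V → ℝ} {L : ℝ}
    (hφ : ∀ z S, |φ (insert z S) - φ S| ≤ L) (m s : ℕ) (S : Set V) (x : V) :
    |expect Q φ (m + s) (insert x S) x - (Q ^ s).mulVec (expect Q φ m S) x| ≤ L * (1 + s * δ) := by
  have h1 := hQ.abs_expect_sub_mulVec_le hφ m s (insert x S) x (Set.mem_insert _ _)
  have h2 := hQ.abs_mulVec_pow_sub_le (fun z => hQ.abs_expect_insert_sub_le hφ m x S z) s x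
  calc _ ≤ _ := abs_sub_le _ _ _
    _ ≤ _ := add_le_add h1 h2
    _ = _ := by ring

theorem IsContractive.sum_mulVec (v : V → ℝ) : ∑ x, Q.mulVec v x = ∑ x, v x := by
  simp only [Matrix.mulVec, dotProduct]
  rw [Finset.sum_comm]
  simp_rw [← Finset.sum_mul, hQ.col_sum, one_mul]

theorem IsContractive.mulVec_const (c : ℝ) : Q.mulVec (fun _ => c) = fun _ => c := by
  ext x
  simp only [Matrix.mulVec, dotProduct]
  rw [← Finset.sum_mul, hQ.row_sum, one_mul]

theorem IsContractive.mulVec_pow_const (s : ℕ) (c : ℝ) :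
    (Q ^ s).mulVec (fun _ => c) = fun _ => c := by
  induction s with
  | zero => simp
  | succ s ih => rw [pow_succ', ← Matrix.mulVec_mulVec, ih, hQ.mulVec_const]

theorem IsContractive.sum_sq_mulVec_pow_le {v : V → ℝ} (hv : ∑ x, v x = 0) (s : ℕ) :
    ∑ x, (Q ^ s).mulVec v x = 0 ∧
      ∑ x, ((Q ^ s).mulVec v x) ^ 2 ≤ (ρ ^ s) ^ 2 * ∑ x, v x ^ 2 := by
  induction s with
  | zero => simpa using hv
  | succ s ih =>
    rw [pow_succ', ← Matrix.mulVec_mulVec]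
    refine ⟨by rw [hQ.sum_mulVec, ih.1], (hQ.contract _ ih.1).trans ?_⟩
    calc _ ≤ ρ ^ 2 * ((ρ ^ s) ^ 2 * ∑ x, v x ^ 2) :=
          mul_le_mul_of_nonneg_left ih.2 (sq_nonneg _)
      _ = _ := by ring

end Basic

/-- The decomposition of a function into its mean and a function of mean zero. -/
theorem sum_sub_mean [Nonempty V] (v : V → ℝ) :
    ∑ x, (v x - (∑ y, v y) / Fintype.card V) = 0 := by
  have : (Fintype.card V : ℝ) ≠ 0 := by positivity
  rw [Finset.sum_sub_distrib, Finset.sum_const, Finset.card_univ, nsmul_eq_mul]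
  field_simp
  ring

theorem sum_sq_sub_mean [Nonempty V] (v : V → ℝ) :
    ∑ x, (v x - (∑ y, v y) / Fintype.card V) ^ 2 =
      ∑ x, v x ^ 2 - (∑ y, v y) ^ 2 / Fintype.card V := by
  have : (Fintype.card V : ℝ) ≠ 0 := by positivity
  have h : ∀ x, (v x - (∑ y, v y) / Fintype.card V) ^ 2 = v x ^ 2 -
      2 * ((∑ y, v y) / Fintype.card V) * v x + ((∑ y, v y) / Fintype.card V) ^ 2 := fun x => by ring
  simp_rw [h]
  rw [Finset.sum_add_distrib, Finset.sum_sub_distrib, ← Finset.mul_sum, Finset.sum_const,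
    Finset.card_univ, nsmul_eq_mul]
  field_simp
  ring

/-! ### Dependence of the expectation on the current position. -/

section Oscillation

variable [DecidableEq V] {Q : Matrix V V ℝ} {δ ρ : ℝ} (hQ : IsContractive Q δ ρ)
include hQ

/-- The chain forgets its starting point at an exponential rate. -/
theorem IsContractive.abs_mulVec_pow_sub_mean_le [Nonempty V] {v : V → ℝ}
    (hv : ∀ x, |v x| ≤ Fintype.card V) (s : ℕ) (x : V) :
    |(Q ^ s).mulVec v x - (∑ y, v y) / Fintype.card V| ≤ ρ ^ s * (Fintype.card V : ℝ) ^ 2 := by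
  set n : ℝ := ((Fintype.card V : ℕ) : ℝ)
  set w : V → ℝ := fun x => v x - (∑ y, v y) / n
  have hn : (1 : ℝ) ≤ n := Nat.one_le_cast.2 Fintype.card_pos
  have h1 : (Q ^ s).mulVec w x = (Q ^ s).mulVec v x - (∑ y, v y) / n := by
    have : w = v - fun _ => (∑ y, v y) / n := rfl
    rw [this, Matrix.mulVec_sub, hQ.mulVec_pow_const]; rfl
  have h2 := (hQ.sum_sq_mulVec_pow_le (v := w) (sum_sub_mean v) s).2
  have h3 : ∑ x, w x ^ 2 ≤ n ^ 4 := by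
    rw [sum_sq_sub_mean v]
    have : ∑ x, v x ^ 2 ≤ ∑ _x : V, n ^ 2 :=
      Finset.sum_le_sum fun x _ => sq_le_sq' (abs_le.1 (hv x)).1 (abs_le.1 (hv x)).2
    rw [Finset.sum_const, Finset.card_univ, nsmul_eq_mul] at this
    have h4 : 0 ≤ (∑ y, v y) ^ 2 / n := by positivity
    have h5 : n * n ^ 2 ≤ n ^ 4 := by nlinarith [pow_pos (by linarith : 0 < n) 3]
    linarith
  rw [← h1]
  -- A single coordinate is bounded by the `ℓ²` norm; this crude passage to the supremum gives the
  -- factor `n²`.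
  refine abs_le_of_sq_le_sq ?_ (mul_nonneg (pow_nonneg hQ.rho_nonneg _) (by positivity))
  calc _ ≤ ∑ x, ((Q ^ s).mulVec w x) ^ 2 :=
        Finset.single_le_sum (f := fun x => ((Q ^ s).mulVec w x) ^ 2) (fun _ _ => sq_nonneg _)
          (Finset.mem_univ x)
    _ ≤ (ρ ^ s) ^ 2 * ∑ x, w x ^ 2 := h2
    _ ≤ (ρ ^ s) ^ 2 * n ^ 4 := mul_le_mul_of_nonneg_left h3 (sq_nonneg _)
    _ = _ := by ring

/-- With few steps left, both sides are close to `φ S`, as few new vertices can be seen. No mixing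
is needed. -/
theorem IsContractive.abs_expect_sub_expect_le {φ : Set V → ℝ} {L : ℝ}
    (hφ : ∀ z S, |φ (insert z S) - φ S| ≤ L) (j : ℕ) (S : Set V) (x y : V) :
    |expect Q φ j (insert x S) x - expect Q φ j (insert y S) y| ≤ 2 * L * (1 + j * δ) := by
  have h (x : V) : |expect Q φ j (insert x S) x - φ S| ≤ L * (1 + j * δ) := by
    have := hQ.abs_expect_insert_sub_mulVec_le hφ 0 j S x
    rwa [zero_add, show expect Q φ 0 S = fun _ => φ S from rfl, hQ.mulVec_pow_const] at this
  have h1 := abs_le.1 (h x)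
  have h2 := abs_le.1 (h y)
  rw [abs_le]
  constructor <;> linarith

/-- The first `s` of the remaining steps are spent on mixing: both sides approach the mean of
`expect Q φ (j - s) S` over the vertices. -/
theorem IsContractive.abs_expect_sub_expect_le_of_mixing [Nonempty V] {φ : Set V → ℝ} {L : ℝ}
    (hφ : ∀ z S, |φ (insert z S) - φ S| ≤ L) (hφ' : ∀ S, |φ S| ≤ Fintype.card V) {s j : ℕ}
    (hs : s ≤ j) (S : Set V) (x y : V) :
    |expect Q φ j (insert x S) x - expect Q φ j (insert y S) y| ≤
      2 * L * (1 + s * δ) + 2 * (ρ ^ s * (Fintype.card V : ℝ) ^ 2) := by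
  obtain ⟨m, rfl⟩ := Nat.exists_eq_add_of_le' hs
  have h1 := fun x => abs_le.1 (hQ.abs_expect_insert_sub_mulVec_le hφ m s S x)
  have h2 := fun x => abs_le.1 (hQ.abs_mulVec_pow_sub_mean_le (fun z => hQ.abs_expect_le hφ' m S z) s x)
  rw [abs_le]
  constructor <;> linarith [h1 x, h1 y, h2 x, h2 y]

end Oscillation

/-- The exponential moment of a random variable with small oscillation. -/
theorem sum_mul_exp_le {q h : V → ℝ} (hq : ∀ y, 0 ≤ q y) (hq1 : ∑ y, q y = 1) {θ B : ℝ}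
    (hθ : 0 ≤ θ) (hB : θ * B ≤ 1) (x : V) (hosc : ∀ y, |h y - h x| ≤ B) :
    ∑ y, q y * Real.exp (θ * h y) ≤
      Real.exp (θ * ∑ y, q y * h y + θ ^ 2 * ∑ y, q y * (h y - h x) ^ 2) := by
  -- The expansion is around `h x`, not around the mean, so that a chain that stays at `x`
  -- contributes nothing to the second moment.
  have h1 (y : V) : Real.exp (θ * h y) ≤ Real.exp (θ * h x) *
      (1 + θ * (h y - h x) + θ ^ 2 * (h y - h x) ^ 2) := by
    have : |θ * (h y - h x)| ≤ 1 := by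
      rw [abs_mul, abs_of_nonneg hθ]
      exact (mul_le_mul_of_nonneg_left (hosc y) hθ).trans hB
    have h2 := (abs_le.1 (Real.abs_exp_sub_one_sub_id_le this)).2
    have h3 : Real.exp (θ * h y) = Real.exp (θ * h x) * Real.exp (θ * (h y - h x)) := by
      rw [← Real.exp_add]; ring_nf
    rw [h3]
    refine mul_le_mul_of_nonneg_left ?_ (Real.exp_pos _).le
    linarith [mul_pow θ (h y - h x) 2]
  have h2 : ∑ y, q y * (1 + θ * (h y - h x) + θ ^ 2 * (h y - h x) ^ 2) =
      θ * (∑ y, q y * h y - h x) + θ ^ 2 * ∑ y, q y * (h y - h x) ^ 2 + 1 := by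
    have : ∀ y, q y * (1 + θ * (h y - h x) + θ ^ 2 * (h y - h x) ^ 2) =
      q y * (1 - θ * h x) + θ * (q y * h y) + θ ^ 2 * (q y * (h y - h x) ^ 2) := fun y => by ring
    simp_rw [this]
    rw [Finset.sum_add_distrib, Finset.sum_add_distrib, ← Finset.sum_mul, ← Finset.mul_sum,
      ← Finset.mul_sum, hq1]
    ring
  calc ∑ y, q y * Real.exp (θ * h y)
      ≤ ∑ y, q y * (Real.exp (θ * h x) * (1 + θ * (h y - h x) + θ ^ 2 * (h y - h x) ^ 2)) :=
        Finset.sum_le_sum fun y _ => mul_le_mul_of_nonneg_left (h1 y) (hq y)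
    _ = Real.exp (θ * h x) * (θ * (∑ y, q y * h y - h x) +
          θ ^ 2 * ∑ y, q y * (h y - h x) ^ 2 + 1) := by
        rw [← h2, Finset.mul_sum]
        exact Finset.sum_congr rfl fun y _ => by ring
    _ ≤ Real.exp (θ * h x) * Real.exp (θ * (∑ y, q y * h y - h x) +
          θ ^ 2 * ∑ y, q y * (h y - h x) ^ 2) :=
        mul_le_mul_of_nonneg_left (Real.add_one_le_exp _) (Real.exp_pos _).le
    _ = _ := by rw [← Real.exp_add]; ring_nf

/-! ### Exponential moments by the martingale method. -/

section Moment

variable [DecidableEq V] {Q : Matrix V V ℝ} {δ ρ : ℝ} (hQ : IsContractive Q δ ρ)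
include hQ

/-- Conditioning on the first step costs `θ²` times the second moment of the change in conditional
expectation. That change vanishes unless the chain moves, so each step costs at most `θ² B² δ`. -/
theorem IsContractive.expect_exp_le {φ : Set V → ℝ} {θ B : ℝ} (hθ : 0 ≤ θ) (hB : θ * B ≤ 1)
    {m : ℕ} (hosc : ∀ j < m, ∀ S x y,
      |expect Q φ j (insert x S) x - expect Q φ j (insert y S) y| ≤ B) (S : Set V) (x : V) :
    expect Q (fun S => Real.exp (θ * φ S)) m S x ≤
      Real.exp (θ * expect Q φ m S x + θ ^ 2 * B ^ 2 * (m * δ)) := by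
  induction m generalizing S x with
  | zero => simp [expect_zero]
  | succ m ih =>
    have hB0 : 0 ≤ B := (abs_nonneg _).trans (hosc m m.lt_succ_self S x x)
    set η : V → ℝ := fun y => expect Q φ m (insert y S) y
    have h1 := sum_mul_exp_le (hQ.nonneg x) (hQ.row_sum x) hθ hB x (h := η)
      fun y => hosc m m.lt_succ_self S y x
    have h2 : ∑ y, Q x y * (η y - η x) ^ 2 ≤ B ^ 2 * δ := by
      refine hQ.sum_le x (by simp) (fun y => ?_) (sq_nonneg B)
      have := abs_le.1 (hosc m m.lt_succ_self S y x)
      exact sq_le_sq' this.1 this.2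
    rw [expect_succ, expect_succ]
    calc _ ≤ ∑ y, Q x y * Real.exp (θ * η y + θ ^ 2 * B ^ 2 * (m * δ)) :=
          Finset.sum_le_sum fun y _ => mul_le_mul_of_nonneg_left
            (ih (fun j hj => hosc j (hj.trans m.lt_succ_self)) _ _) (hQ.nonneg x y)
      _ = (∑ y, Q x y * Real.exp (θ * η y)) * Real.exp (θ ^ 2 * B ^ 2 * (m * δ)) := by
          rw [Finset.sum_mul]
          exact Finset.sum_congr rfl fun y _ => by
            rw [Real.exp_add, ← mul_assoc]
      _ ≤ Real.exp (θ * ∑ y, Q x y * η y + θ ^ 2 * ∑ y, Q x y * (η y - η x) ^ 2) *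
            Real.exp (θ ^ 2 * B ^ 2 * (m * δ)) :=
          mul_le_mul_of_nonneg_right h1 (Real.exp_pos _).le
      _ ≤ _ := by
          rw [← Real.exp_add, Real.exp_le_exp]
          have := mul_le_mul_of_nonneg_left h2 (sq_nonneg θ)
          push_cast
          linarith

/-- The exponential moment of a function of the visited set, started from equilibrium. -/
theorem IsContractive.sum_expect_exp_le [Nonempty V] {φ : Set V → ℝ} {θ B : ℝ} (hθ : 0 ≤ θ)
    (hB : θ * B ≤ 1) {m : ℕ} (hosc : ∀ j ≤ m, ∀ S x y,
      |expect Q φ j (insert x S) x - expect Q φ j (insert y S) y| ≤ B) :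
    ∑ x, 1 / (Fintype.card V : ℝ) * expect Q (fun S => Real.exp (θ * φ S)) m {x} x ≤
      Real.exp (θ * ∑ x, 1 / (Fintype.card V : ℝ) * expect Q φ m {x} x +
        θ ^ 2 * B ^ 2 * (1 + m * δ)) := by
  have hn : (Fintype.card V : ℝ) ≠ 0 := by positivity
  set q : V → ℝ := fun _ => 1 / (Fintype.card V : ℝ)
  have hq : ∀ y, 0 ≤ q y := fun y => by positivity
  have hq1 : ∑ y, q y = 1 := by simp [q]
  -- The uniform initial law is compared with an arbitrary vertex. It has no atom of mass near one,
  -- so it costs the full `B²`: this is the `1` in `1 + m * δ`.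
  obtain ⟨x₀⟩ := ‹Nonempty V›
  set η : V → ℝ := fun y => expect Q φ m {y} y
  have ho : ∀ y, |η y - η x₀| ≤ B := fun y => by
    simpa using hosc m le_rfl ∅ y x₀
  have h1 := sum_mul_exp_le hq hq1 hθ hB x₀ (h := η) ho
  have h2 : ∑ y, q y * (η y - η x₀) ^ 2 ≤ B ^ 2 := by
    calc _ ≤ ∑ y, q y * B ^ 2 := Finset.sum_le_sum fun y _ => mul_le_mul_of_nonneg_left
            (sq_le_sq' (abs_le.1 (ho y)).1 (abs_le.1 (ho y)).2) (hq y)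
      _ = B ^ 2 := by rw [← Finset.sum_mul, hq1, one_mul]
  calc _ ≤ ∑ y, q y * Real.exp (θ * η y + θ ^ 2 * B ^ 2 * (m * δ)) :=
        Finset.sum_le_sum fun y _ => mul_le_mul_of_nonneg_left
          (hQ.expect_exp_le hθ hB (fun j hj => hosc j hj.le) _ _) (hq y)
    _ = (∑ y, q y * Real.exp (θ * η y)) * Real.exp (θ ^ 2 * B ^ 2 * (m * δ)) := by
        rw [Finset.sum_mul]
        exact Finset.sum_congr rfl fun y _ => by
            rw [Real.exp_add, ← mul_assoc]
    _ ≤ Real.exp (θ * ∑ y, q y * η y + θ ^ 2 * ∑ y, q y * (η y - η x₀) ^ 2) *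
          Real.exp (θ ^ 2 * B ^ 2 * (m * δ)) :=
        mul_le_mul_of_nonneg_right h1 (Real.exp_pos _).le
    _ ≤ _ := by
        rw [← Real.exp_add, Real.exp_le_exp]
        have := mul_le_mul_of_nonneg_left h2 (sq_nonneg θ)
        linarith

end Moment

-- Avoiding `A` turns the chain into one killed on `A`, whose evolution no longer needs the visited
-- set.
open Classical in
theorem expect_avoid [DecidableEq V] (Q : Matrix V V ℝ) (A : Finset V) (m : ℕ) (S : Set V) (x : V) :
    expect Q (fun S => if Disjoint (A : Set V) S then 1 else 0) m S x =
      if Disjoint (A : Set V) S then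
        ((fun v : V → ℝ => Q.mulVec fun y => if y ∈ A then 0 else v y)^[m] fun _ => 1) x
      else 0 := by
  induction m generalizing S x with
  | zero => rfl
  | succ m ih =>
    rw [expect_succ, Function.iterate_succ_apply']
    simp_rw [ih, Set.disjoint_insert_right]
    by_cases hS : Disjoint (A : Set V) S
    · simp only [hS, and_true, if_true, Matrix.mulVec, dotProduct]
      refine Finset.sum_congr rfl fun y _ => ?_
      by_cases hy : y ∈ A <;> simp [hy]
    · simp [hS]

section Avoid

variable [DecidableEq V] {Q : Matrix V V ℝ} {δ ρ : ℝ} (hQ : IsContractive Q δ ρ)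
include hQ

open Classical in
/-- A function that vanishes on `A` is contracted by `Q`. -/
theorem IsContractive.sum_sq_mulVec_le [Nonempty V] (hρ : ρ ≤ 1) (A : Finset V) {a : V → ℝ}
    (ha : ∀ x ∈ A, a x = 0) :
    ∑ x, (Q.mulVec a x) ^ 2 ≤ (1 - A.card / Fintype.card V * (1 - ρ ^ 2)) * ∑ x, a x ^ 2 := by
  set n : ℝ := ((Fintype.card V : ℕ) : ℝ)
  have hn : 0 < n := by positivity
  set μ : ℝ := (∑ y, a y) / n
  set w : V → ℝ := fun x => a x - μ
  have h1 := hQ.contract w (sum_sub_mean a)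
  have h2 : ∑ x, (Q.mulVec a x) ^ 2 = n * μ ^ 2 + ∑ x, (Q.mulVec w x) ^ 2 := by
    have h3 : ∀ x, Q.mulVec a x = μ + Q.mulVec w x := fun x => by
      have : w = a - fun _ => μ := rfl
      rw [this, Matrix.mulVec_sub, hQ.mulVec_const]
      simp
    simp_rw [h3, add_sq]
    rw [Finset.sum_add_distrib, Finset.sum_add_distrib, ← Finset.mul_sum, hQ.sum_mulVec,
      sum_sub_mean a, Finset.sum_const, Finset.card_univ, nsmul_eq_mul]
    ring
  have h3 : ∑ x, w x ^ 2 = ∑ x, a x ^ 2 - n * μ ^ 2 := by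
    rw [sum_sq_sub_mean a]
    change _ - (∑ y, a y) ^ 2 / n = _
    simp only [μ]
    field_simp
  -- Cauchy–Schwarz on the complement of `A`: a function vanishing on `A` cannot be nearly constant,
  -- so a share of its norm lies in the part contracted by `ρ`.
  have h4 : n * μ ^ 2 ≤ (1 - A.card / n) * ∑ x, a x ^ 2 := by
    have h5 : ∑ x, a x = ∑ x ∈ Aᶜ, a x := by
      rw [← Finset.sum_add_sum_compl A, Finset.sum_eq_zero ha, zero_add]
    have h6 : (∑ x ∈ Aᶜ, a x) ^ 2 ≤ (Aᶜ.card : ℝ) * ∑ x ∈ Aᶜ, a x ^ 2 := sq_sum_le_card_mul_sum_sq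
    have h7 : ∑ x ∈ Aᶜ, a x ^ 2 ≤ ∑ x, a x ^ 2 :=
      Finset.sum_le_univ_sum_of_nonneg fun x => sq_nonneg _
    have h8 : (Aᶜ.card : ℝ) = n - A.card := by
      rw [Finset.card_compl, Nat.cast_sub (Finset.card_le_univ A)]
    have h9 : n * μ ^ 2 = (∑ x, a x) ^ 2 / n := by simp only [μ]; field_simp
    rw [h9, h5, div_le_iff₀ hn]
    calc _ ≤ _ := h6
      _ ≤ (Aᶜ.card : ℝ) * ∑ x, a x ^ 2 := mul_le_mul_of_nonneg_left h7 (Nat.cast_nonneg _)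
      _ = _ := by rw [h8]; field_simp
  have h5 : ρ ^ 2 ≤ 1 := pow_le_one₀ hQ.rho_nonneg hρ
  rw [h2]
  rw [h3] at h1
  nlinarith [mul_le_mul_of_nonneg_left h4 (sub_nonneg.2 h5)]

open Classical in
/-- The probability, started from equilibrium, to avoid the set `A` for `m` steps. -/
theorem IsContractive.sum_expect_avoid_sq_le [Nonempty V] (hρ : ρ ≤ 1) (A : Finset V) (m : ℕ) :
    (∑ x, 1 / (Fintype.card V : ℝ) *
      expect Q (fun S => if Disjoint (A : Set V) S then 1 else 0) m {x} x) ^ 2 ≤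
      (1 - A.card / Fintype.card V * (1 - ρ ^ 2)) ^ m := by
  set n : ℝ := ((Fintype.card V : ℕ) : ℝ)
  have hn : 0 < n := by positivity
  set κ : ℝ := 1 - A.card / n * (1 - ρ ^ 2)
  have hκ : 0 ≤ κ := by
    have h1 : (A.card : ℝ) / n ≤ 1 := by
      rw [div_le_one hn]; exact Nat.cast_le.2 (Finset.card_le_univ A)
    have h2 : 0 ≤ (A.card : ℝ) / n := by positivity
    have h3 : ρ ^ 2 ≤ 1 := pow_le_one₀ hQ.rho_nonneg hρ
    simp only [κ]
    nlinarith [sq_nonneg ρ]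
  set w : ℕ → V → ℝ := fun m =>
    (fun v : V → ℝ => Q.mulVec fun y => if y ∈ A then 0 else v y)^[m] fun _ => 1
  set a : ℕ → V → ℝ := fun m x => if x ∈ A then 0 else w m x
  have ha_le : ∀ m, ∑ x, a m x ^ 2 ≤ ∑ x, w m x ^ 2 := fun m =>
    Finset.sum_le_sum fun x _ => by
      by_cases hx : x ∈ A <;> simp [a, hx, sq_nonneg]
  have hw : ∀ m, ∑ x, w m x ^ 2 ≤ κ ^ m * n := by
    intro m
    induction m with
    | zero => simp [w, n]
    | succ m ih =>
      have h1 : w (m + 1) = Q.mulVec (a m) := Function.iterate_succ_apply' _ _ _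
      rw [h1]
      calc _ ≤ κ * ∑ x, a m x ^ 2 := hQ.sum_sq_mulVec_le hρ A fun x hx => by simp [a, hx]
        _ ≤ κ * (κ ^ m * n) := mul_le_mul_of_nonneg_left ((ha_le m).trans ih) hκ
        _ = _ := by ring
  have h1 : ∀ x, expect Q (fun S => if Disjoint (A : Set V) S then 1 else 0) m {x} x = a m x := by
    intro x
    rw [expect_avoid Q]
    by_cases hx : x ∈ A <;> simp [a, hx, w]
  simp_rw [h1]
  rw [← Finset.mul_sum, mul_pow]
  have h2 : (∑ x, a m x) ^ 2 ≤ n * ∑ x, a m x ^ 2 := by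
    simpa [n] using sq_sum_le_card_mul_sum_sq (s := Finset.univ) (f := a m)
  calc (1 / n) ^ 2 * (∑ x, a m x) ^ 2 ≤ (1 / n) ^ 2 * (n * (κ ^ m * n)) := by
        refine mul_le_mul_of_nonneg_left (h2.trans ?_) (sq_nonneg _)
        exact mul_le_mul_of_nonneg_left ((ha_le m).trans (hw m)) hn.le
    _ = κ ^ m := by field_simp

end Avoid

end VisitedChain

/-! ### The heat kernel of a regular multigraph -/

namespace Graph

theorem numEdges_comm {V β : Type*} (G : Graph V β) (x y : V) : G.numEdges x y = G.numEdges y x := by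
  unfold numEdges
  by_cases h : x = y
  · subst h; rfl
  · rw [if_neg h, if_neg (Ne.symm h)]
    simp_rw [isLink_comm (x := x) (y := y)]

variable {V β : Type*} [Fintype V]

section Regular

variable {G : Graph V β} {d : ℕ} (hG : G.IsRegularMultigraph d)
include hG

theorem IsRegularMultigraph.transProb_comm (x y : V) : G.transProb x y = G.transProb y x := by
  rw [transProb, transProb, hG.degree_eq, hG.degree_eq, numEdges_comm]

/-- The quotient `d / d` is `1` for `d > 0` and `0` for `d = 0`, so both cases are treated together.
-/
theorem IsRegularMultigraph.sum_transProb (x : V) : ∑ y, G.transProb x y = (d : ℝ) / d := by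
  simp_rw [transProb, hG.degree_eq]
  rw [← Finset.sum_div, ← hG.degree_eq x, degree]
  push_cast
  rfl

open Classical in
theorem IsRegularMultigraph.generator_eq :
    G.generator = Matrix.of G.transProb - ((d : ℝ) / d) • (1 : Matrix V V ℝ) := by
  ext x y
  simp [generator, hG.sum_transProb, Matrix.one_apply]

theorem IsRegularMultigraph.generator_comm (x y : V) : G.generator x y = G.generator y x := by
  classical
  simp [hG.generator_eq, hG.transProb_comm x y, Matrix.one_apply, eq_comm]

theorem IsRegularMultigraph.sum_generator (x : V) : ∑ y, G.generator x y = 0 := by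
  classical
  simp [hG.generator_eq, hG.sum_transProb, Matrix.one_apply]

theorem IsRegularMultigraph.dirichletForm_self (f : V → ℝ) :
    G.dirichletForm f f = -(unif V * ∑ x, f x * G.generator.mulVec f x) := by
  classical
  set r : ℝ := (d : ℝ) / d
  have h1 : ∀ x, f x * G.generator.mulVec f x =
      ∑ y, f x * f y * G.transProb x y - r * f x ^ 2 := fun x => by
    rw [hG.generator_eq, Matrix.sub_mulVec, Matrix.smul_mulVec, Matrix.one_mulVec]
    simp only [Pi.sub_apply, Pi.smul_apply, smul_eq_mul, Matrix.mulVec, dotProduct, Matrix.of_apply]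
    rw [mul_sub, Finset.mul_sum]
    congr 1
    · exact Finset.sum_congr rfl fun y _ => by ring
    · ring
  have h2 : ∑ x, ∑ y, f x ^ 2 * G.transProb x y = r * ∑ x, f x ^ 2 := by
    simp_rw [← Finset.mul_sum, hG.sum_transProb, ← Finset.sum_mul]
    ring
  have h3 : ∑ x, ∑ y, f y ^ 2 * G.transProb x y = r * ∑ x, f x ^ 2 := by
    rw [← h2, Finset.sum_comm]
    simp_rw [fun x y => hG.transProb_comm x y]
  have h4 : ∀ x y, (f x - f y) * (f x - f y) * unif V * G.transProb x y =
      unif V * (f x ^ 2 * G.transProb x y + f y ^ 2 * G.transProb x y -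
        2 * (f x * f y * G.transProb x y)) := fun x y => by ring
  simp_rw [dirichletForm, h4, h1, ← Finset.mul_sum, Finset.sum_sub_distrib, Finset.sum_add_distrib,
    ← Finset.mul_sum]
  simp_rw [Finset.mul_sum] at h2 h3 ⊢
  simp_rw [← Finset.mul_sum] at h2 h3 ⊢
  rw [h2, h3]
  ring

end Regular

theorem transProb_nonneg (G : Graph V β) (x y : V) : 0 ≤ G.transProb x y := by
  unfold transProb; positivity

section

attribute [local instance] Matrix.linftyOpNormedRing Matrix.linftyOpNormedAlgebra

variable [DecidableEq V]

theorem _root_.Matrix.hasSum_exp_apply (A : Matrix V V ℝ) (x y : V) :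
    HasSum (fun k : ℕ => (k.factorial : ℝ)⁻¹ * (A ^ k) x y) (NormedSpace.exp A x y) := by
  have := NormedSpace.exp_series_hasSum_exp' (𝕂 := ℝ) A
  have h := Pi.hasSum.1 (Pi.hasSum.1 this x) y
  simp only [Matrix.smul_apply, smul_eq_mul] at h
  exact h

theorem _root_.Matrix.exp_apply_nonneg {A : Matrix V V ℝ} (hA : ∀ x y, 0 ≤ A x y) (x y : V) :
    0 ≤ NormedSpace.exp A x y :=
  (Matrix.hasSum_exp_apply A x y).nonneg fun k =>
    mul_nonneg (by positivity) (Matrix.pow_apply_nonneg hA k x y)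

theorem _root_.Matrix.one_le_exp_apply_self {A : Matrix V V ℝ} (hA : ∀ x y, 0 ≤ A x y) (x : V) :
    1 ≤ NormedSpace.exp A x x := by
  have := le_hasSum (Matrix.hasSum_exp_apply A x x) 0 fun k _ =>
    mul_nonneg (by positivity) (Matrix.pow_apply_nonneg hA k x x)
  simpa using this

theorem _root_.Matrix.exp_sub_smul_one (A : Matrix V V ℝ) (r : ℝ) :
    NormedSpace.exp (A - r • (1 : Matrix V V ℝ)) = Real.exp (-r) • NormedSpace.exp A := by
  have h1 : A - r • (1 : Matrix V V ℝ) = A + algebraMap ℝ (Matrix V V ℝ) (-r) := by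
    rw [Algebra.algebraMap_eq_smul_one, neg_smul, sub_eq_add_neg]
  have h2 : NormedSpace.exp (algebraMap ℝ (Matrix V V ℝ) (-r)) =
      algebraMap ℝ (Matrix V V ℝ) (Real.exp (-r)) := by
    rw [Real.exp_eq_exp_ℝ]
    exact (NormedSpace.algebraMap_exp_comm (𝔸 := Matrix V V ℝ) (-r)).symm
  rw [h1, Matrix.exp_add_of_commute _ _ (Algebra.commutes (-r) A).symm, h2, ← Algebra.commutes,
    Algebra.smul_def]

/-- The heat flow of a matrix solves the heat equation. -/
theorem _root_.Matrix.hasDerivAt_exp_smul_mulVec (A : Matrix V V ℝ) (v : V → ℝ) (x : V) (t : ℝ) :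
    HasDerivAt (fun t : ℝ => (NormedSpace.exp (t • A)).mulVec v x)
      (A.mulVec ((NormedSpace.exp (t • A)).mulVec v) x) t := by
  have h1 := hasDerivAt_exp_smul_const' (𝕂 := ℝ) A t
  have h2 : ∀ y, HasDerivAt (fun t : ℝ => NormedSpace.exp (t • A) x y)
      ((A * NormedSpace.exp (t • A)) x y) t := fun y =>
    hasDerivAt_pi.1 (hasDerivAt_pi.1 h1 x) y
  rw [Matrix.mulVec_mulVec]
  exact HasDerivAt.fun_sum fun y _ => (h2 y).mul_const (v y)

end

/-! ### Stochasticity and spectral contraction of the heat semigroup. -/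

section Regular

variable {G : Graph V β} {d : ℕ} (hG : G.IsRegularMultigraph d)
include hG

theorem IsRegularMultigraph.heatKernel_comm (t : ℝ≥0) (x y : V) :
    G.heatKernel t x y = G.heatKernel t y x := by
  classical
  have h : G.generator.IsSymm := Matrix.IsSymm.ext fun x y => hG.generator_comm y x
  have := (h.smul (t : ℝ)).exp
  unfold heatKernel
  convert this.apply y x

theorem IsRegularMultigraph.sum_mulVec_generator (v : V → ℝ) :
    ∑ x, G.generator.mulVec v x = 0 := by
  simp only [Matrix.mulVec, dotProduct]
  rw [Finset.sum_comm]
  simp_rw [fun x y => hG.generator_comm x y, ← Finset.sum_mul, hG.sum_generator]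
  simp

open Classical in
theorem IsRegularMultigraph.sum_mulVec_heat (v : V → ℝ) (t : ℝ) :
    ∑ x, (NormedSpace.exp (t • G.generator)).mulVec v x = ∑ x, v x := by
  have h : ∀ t, HasDerivAt (fun t : ℝ => ∑ x, (NormedSpace.exp (t • G.generator)).mulVec v x)
      0 t := fun t => by
    have := HasDerivAt.fun_sum (u := Finset.univ) fun x _ =>
      Matrix.hasDerivAt_exp_smul_mulVec G.generator v x t
    rwa [hG.sum_mulVec_generator] at this
  have := is_const_of_deriv_eq_zero (fun t => (h t).differentiableAt) (fun t => (h t).deriv) t 0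
  simpa using this

theorem IsRegularMultigraph.sum_heatKernel_left (t : ℝ≥0) (y : V) :
    ∑ x, G.heatKernel t x y = 1 := by
  classical
  have := hG.sum_mulVec_heat (Pi.single y 1) t
  simpa [heatKernel] using this

theorem IsRegularMultigraph.sum_heatKernel (t : ℝ≥0) (x : V) :
    ∑ y, G.heatKernel t x y = 1 := by
  simp_rw [fun y => hG.heatKernel_comm t x y, hG.sum_heatKernel_left]

-- Removing the diagonal part of the generator leaves the exponential of a nonnegative matrix, which
-- yields positivity and the lower bound on the diagonal.
open Classical in
theorem IsRegularMultigraph.heatKernel_eq (t : ℝ≥0) (x y : V) :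
    G.heatKernel t x y = Real.exp (-(t * ((d : ℝ) / d))) *
      NormedSpace.exp ((t : ℝ) • (Matrix.of G.transProb : Matrix V V ℝ)) x y := by
  rw [heatKernel, hG.generator_eq, smul_sub, smul_smul, Matrix.exp_sub_smul_one]
  rfl

theorem IsRegularMultigraph.heatKernel_nonneg (t : ℝ≥0) (x y : V) : 0 ≤ G.heatKernel t x y := by
  classical
  rw [hG.heatKernel_eq]
  exact mul_nonneg (Real.exp_pos _).le (Matrix.exp_apply_nonneg
    (fun x y => mul_nonneg t.2 (transProb_nonneg G x y)) x y)

theorem IsRegularMultigraph.one_sub_le_heatKernel (t : ℝ≥0) (x : V) :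
    1 - (t : ℝ) ≤ G.heatKernel t x x := by
  classical
  rw [hG.heatKernel_eq]
  have h1 := Matrix.one_le_exp_apply_self (A := (t : ℝ) • (Matrix.of G.transProb : Matrix V V ℝ))
    (fun x y => mul_nonneg t.2 (transProb_nonneg G x y)) x
  have h2 : (t : ℝ) * ((d : ℝ) / d) ≤ t := mul_le_of_le_one_right t.2 (div_self_le_one _)
  calc 1 - (t : ℝ) ≤ Real.exp (-(t * ((d : ℝ) / d))) := by
        linarith [Real.add_one_le_exp (-(t * ((d : ℝ) / d)))]
    _ ≤ _ := le_mul_of_one_le_right (Real.exp_pos _).le h1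

/-- The spectral gap controls the generator on functions of mean zero. -/
theorem IsRegularMultigraph.sum_mul_generator_le [Nonempty V] {α : ℝ}
    (hα : (α : EReal) ≤ G.spectralGap) {f : V → ℝ} (hf : ∑ x, f x = 0) :
    ∑ x, f x * G.generator.mulVec f x ≤ -α * ∑ x, f x ^ 2 := by
  have hu : 0 < unif V := by unfold unif; positivity
  rcases (Finset.sum_nonneg fun x (_ : x ∈ Finset.univ) => sq_nonneg (f x)).eq_or_lt with h0 | h0
  · have : ∀ x, f x = 0 := fun x => by
      simpa using (Finset.sum_eq_zero_iff_of_nonneg (fun x _ => sq_nonneg (f x))).1 h0.symm x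
        (Finset.mem_univ x)
    simp [this]
  · set s : ℝ := ∑ x, f x ^ 2
    set c : ℝ := Real.sqrt (1 / (unif V * s))
    have hc : c ^ 2 = 1 / (unif V * s) := Real.sq_sqrt (by positivity)
    have h1 : ((α : ℝ) : EReal) ≤ (G.dirichletForm (c • f) (c • f) : ℝ) := by
      refine hα.trans (sInf_le ⟨c • f, ?_, ?_, rfl⟩)
      · simp_rw [Pi.smul_apply, smul_eq_mul, mul_pow]
        rw [← Finset.mul_sum, ← Finset.mul_sum, hc]
        change unif V * (1 / (unif V * s) * s) = 1
        field_simp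
      · simp_rw [Pi.smul_apply, smul_eq_mul]
        rw [← Finset.mul_sum, ← Finset.mul_sum, hf]; simp
    rw [EReal.coe_le_coe_iff, hG.dirichletForm_self, Matrix.mulVec_smul] at h1
    have h2 : ∑ x, (c • f) x * (c • G.generator.mulVec f) x =
        c ^ 2 * ∑ x, f x * G.generator.mulVec f x := by
      rw [Finset.mul_sum]
      exact Finset.sum_congr rfl fun x _ => by simp only [Pi.smul_apply, smul_eq_mul]; ring
    rw [h2, hc] at h1
    set D : ℝ := ∑ x, f x * G.generator.mulVec f x
    have h3 : -(unif V * (1 / (unif V * s) * D)) = -D / s := by field_simp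
    rw [h3, le_div_iff₀ h0] at h1
    linarith

open Classical in
/-- The heat semigroup contracts functions of mean zero. -/
theorem IsRegularMultigraph.sum_sq_heat_le [Nonempty V] {α : ℝ}
    (hα : (α : EReal) ≤ G.spectralGap) {v : V → ℝ} (hv : ∑ x, v x = 0) {t : ℝ} (ht : 0 ≤ t) :
    ∑ x, ((NormedSpace.exp (t • G.generator)).mulVec v x) ^ 2 ≤
      Real.exp (-α * t) ^ 2 * ∑ x, v x ^ 2 := by
  set w : ℝ → V → ℝ := fun t => (NormedSpace.exp (t • G.generator)).mulVec v
  have h1 : ∀ t, HasDerivAt (fun t => Real.exp (2 * α * t) * ∑ x, w t x ^ 2)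
      (Real.exp (2 * α * t) * (2 * α) * (∑ x, w t x ^ 2) +
        Real.exp (2 * α * t) * ∑ x, 2 * w t x * G.generator.mulVec (w t) x) t := fun t => by
    refine HasDerivAt.mul ?_ ?_
    · simpa using ((hasDerivAt_id t).const_mul (2 * α)).exp
    · refine HasDerivAt.fun_sum fun x _ => ?_
      simpa only [Nat.cast_ofNat, Nat.add_one_sub_one, pow_one] using
        (Matrix.hasDerivAt_exp_smul_mulVec G.generator v x t).fun_pow 2
  -- Grönwall's argument: the gap makes the derivative of the squared norm at most `-2 α` times
  -- itself.
  have h2 : Antitone (fun t => Real.exp (2 * α * t) * ∑ x, w t x ^ 2) := by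
    refine antitone_of_hasDerivAt_nonpos h1 fun t => ?_
    have h3 := hG.sum_mul_generator_le hα (f := w t) (by rw [hG.sum_mulVec_heat, hv])
    simp_rw [mul_assoc (2 : ℝ)]
    rw [← Finset.mul_sum]
    have h4 := mul_le_mul_of_nonneg_left h3 (Real.exp_pos (2 * (α * t))).le
    simp only [Pi.zero_apply]
    linarith
  have h3 := h2 ht
  have h4 : w 0 = v := by simp [w]
  simp only [mul_zero, Real.exp_zero, one_mul, h4] at h3
  have h5 : Real.exp (-α * t) ^ 2 * Real.exp (2 * α * t) = 1 := by
    rw [← Real.exp_nat_mul, ← Real.exp_add, Real.exp_eq_one_iff]; push_cast; ring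
  calc _ = Real.exp (-α * t) ^ 2 * (Real.exp (2 * α * t) * ∑ x, w t x ^ 2) := by
        rw [← mul_assoc, h5, one_mul]
    _ ≤ _ := mul_le_mul_of_nonneg_left h3 (sq_nonneg _)

theorem IsRegularMultigraph.isContractive_heatKernel [Nonempty V] [DecidableEq V] {α : ℝ}
    (hα : (α : EReal) ≤ G.spectralGap) (t : ℝ≥0) :
    VisitedChain.IsContractive (Matrix.of (G.heatKernel t)) t (Real.exp (-α * t)) where
  nonneg := hG.heatKernel_nonneg t
  row_sum := hG.sum_heatKernel t
  col_sum := hG.sum_heatKernel_left t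
  diag := hG.one_sub_le_heatKernel t
  rho_nonneg := (Real.exp_pos _).le
  contract _ hv := hG.sum_sq_heat_le hα hv t.2

end Regular

end Graph

/-! ### The degrees in the graph induced by the unvisited vertices -/

namespace Graph

variable {V β : Type*}

/-- The subgraph of the edges that have no end in `S`. -/
def avoiding (G : Graph V β) (S : Set V) : Graph V β := G.restrict {e | ∀ x, G.Inc e x → x ∉ S}

theorem vacantGraph_eq_avoiding [Fintype V] (G : Graph V β) (w : ℝ≥0 → V) (u : ℝ≥0) :
    G.vacantGraph w u = G.avoiding (w '' Set.Iic (u * (Fintype.card V : ℝ≥0))) := by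
  unfold vacantGraph avoiding vacantSet
  simp

theorem avoiding_isLink (G : Graph V β) (S : Set V) (e : β) (x y : V) :
    (G.avoiding S).IsLink e x y ↔ G.IsLink e x y ∧ x ∉ S ∧ y ∉ S := by
  unfold avoiding
  rw [restrict_isLink]
  constructor
  · rintro ⟨h1, h2⟩
    exact ⟨h2, h1 x h2.inc_left, h1 y h2.inc_right⟩
  · rintro ⟨h1, h2, h3⟩
    refine ⟨fun z hz => ?_, h1⟩
    rcases hz.eq_or_eq_of_isLink h1 with rfl | rfl <;> assumption

theorem numEdges_avoiding_of_mem (G : Graph V β) {S : Set V} {x y : V} (h : x ∈ S ∨ y ∈ S) :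
    (G.avoiding S).numEdges x y = 0 := by
  have h1 : ∀ e, ¬ (G.avoiding S).IsLink e x y := fun e he => by
    have := (G.avoiding_isLink S e x y).1 he
    tauto
  unfold numEdges
  split_ifs with hxy
  · subst hxy
    simp only [IsLoopAt, h1]
    simp
  · simp [h1]

theorem numEdges_avoiding_of_not_mem (G : Graph V β) {S : Set V} {x y : V} (hx : x ∉ S)
    (hy : y ∉ S) : (G.avoiding S).numEdges x y = G.numEdges x y := by
  unfold numEdges IsLoopAt
  simp_rw [avoiding_isLink]
  simp [hx, hy]

variable [Fintype V]

theorem degree_avoiding_of_mem (G : Graph V β) {S : Set V} {x : V} (h : x ∈ S) :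
    (G.avoiding S).degree x = 0 :=
  Finset.sum_eq_zero fun _ _ => G.numEdges_avoiding_of_mem (Or.inl h)

theorem degree_avoiding_insert (G : Graph V β) {S : Set V} {x z : V} (hxz : x ≠ z)
    (h : G.numEdges x z = 0) : (G.avoiding (insert z S)).degree x = (G.avoiding S).degree x := by
  refine Finset.sum_congr rfl fun y _ => ?_
  by_cases hx : x ∈ S
  · rw [numEdges_avoiding_of_mem _ (Or.inl hx),
      numEdges_avoiding_of_mem _ (Or.inl (Set.mem_insert_of_mem z hx))]
  have hx' : x ∉ insert z S := by simp [hx, hxz]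
  by_cases hy : y ∈ S
  · rw [numEdges_avoiding_of_mem _ (Or.inr hy),
      numEdges_avoiding_of_mem _ (Or.inr (Set.mem_insert_of_mem z hy))]
  by_cases hyz : y = z
  · subst hyz
    rw [numEdges_avoiding_of_mem _ (Or.inr (Set.mem_insert y S)),
      numEdges_avoiding_of_not_mem _ hx hy, h]
  · rw [numEdges_avoiding_of_not_mem _ hx hy,
      numEdges_avoiding_of_not_mem _ hx' (by simp [hy, hyz])]

/-- The number of vertices of degree `i` in the subgraph of the edges without an end in `S`. -/
noncomputable def countDegree (G : Graph V β) (i : ℕ) (S : Set V) : ℝ := (G.avoiding S).numVerticesOfDegree i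

theorem countDegree_nonneg (G : Graph V β) (i : ℕ) (S : Set V) : 0 ≤ G.countDegree i S :=
  Nat.cast_nonneg _

theorem countDegree_le (G : Graph V β) (i : ℕ) (S : Set V) :
    G.countDegree i S ≤ Fintype.card V := by
  unfold countDegree numVerticesOfDegree
  rw [← Nat.card_eq_fintype_card, ← Set.ncard_univ]
  exact_mod_cast Set.ncard_le_ncard (Set.subset_univ _)

theorem IsRegularMultigraph.ncard_neighbors_le {G : Graph V β} {d : ℕ}
    (hG : G.IsRegularMultigraph d) (z : V) : {x | G.numEdges x z ≠ 0}.ncard ≤ d := by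
  classical
  rw [← hG.degree_eq z, degree]
  have h : {x | G.numEdges x z ≠ 0} = ((Finset.univ.filter fun x => G.numEdges z x ≠ 0 :
      Finset V) : Set V) := by
    ext x
    simp [numEdges_comm G x z]
  rw [h, Set.ncard_coe_finset, Finset.card_eq_sum_ones]
  calc _ ≤ ∑ x ∈ Finset.univ.filter fun x => G.numEdges z x ≠ 0, G.numEdges z x :=
        Finset.sum_le_sum fun x hx => Nat.one_le_iff_ne_zero.2 (Finset.mem_filter.1 hx).2
    _ ≤ _ := Finset.sum_le_sum_of_subset (Finset.filter_subset _ _)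

/-- Visiting one more vertex changes the degree counts by at most `d + 1`. -/
theorem IsRegularMultigraph.abs_countDegree_insert_sub_le {G : Graph V β} {d : ℕ}
    (hG : G.IsRegularMultigraph d) (i : ℕ) (z : V) (S : Set V) :
    |G.countDegree i (insert z S) - G.countDegree i S| ≤ d + 1 := by
  -- Only `z` and its at most `d` neighbours can change degree.
  set N : Set V := insert z {x | G.numEdges x z ≠ 0}
  have hN : N.ncard ≤ d + 1 := (Set.ncard_insert_le _ _).trans
    (Nat.add_le_add_right (hG.ncard_neighbors_le z) 1)
  have heq : ∀ x ∉ N, (G.avoiding (insert z S)).degree x = (G.avoiding S).degree x := by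
    intro x hx
    simp only [N, Set.mem_insert_iff, Set.mem_ofPred_eq, not_or, not_not] at hx
    exact G.degree_avoiding_insert hx.1 hx.2
  have key : ∀ S₁ S₂ : Set V, (∀ x ∉ N, (G.avoiding S₁).degree x = (G.avoiding S₂).degree x) →
      G.countDegree i S₁ ≤ G.countDegree i S₂ + (d + 1) := by
    intro S₁ S₂ h
    have h1 : {x | (G.avoiding S₁).degree x = i} ⊆ {x | (G.avoiding S₂).degree x = i} ∪ N := by
      intro x hx
      by_cases hxN : x ∈ N
      · exact Or.inr hxN
      · exact Or.inl ((h x hxN).symm.trans hx)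
    have h2 := (Set.ncard_le_ncard h1).trans (Set.ncard_union_le _ _)
    unfold countDegree numVerticesOfDegree
    exact_mod_cast h2.trans (Nat.add_le_add_left hN _)
  have h1 := key _ _ heq
  have h2 := key _ _ fun x hx => (heq x hx).symm
  rw [abs_le]
  constructor <;> linarith

/-- A visited vertex is isolated, so only unvisited ones can have nonzero degree. -/
theorem countDegree_le_ncard_compl (G : Graph V β) {i : ℕ} (hi : i ≠ 0) (S : Set V) :
    G.countDegree i S ≤ Sᶜ.ncard := by
  unfold countDegree numVerticesOfDegree
  refine Nat.cast_le.2 (Set.ncard_le_ncard fun x hx hxS => hi ?_)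
  have h : (G.avoiding S).degree x = i := hx
  rw [← h, G.degree_avoiding_of_mem hxS]

theorem card_sub_countDegree_zero_le (G : Graph V β) (S : Set V) :
    Fintype.card V - G.countDegree 0 S ≤ Sᶜ.ncard := by
  have h : S ⊆ {x | (G.avoiding S).degree x = 0} := fun x hx => G.degree_avoiding_of_mem hx
  have h1 := Set.ncard_le_ncard h
  have h2 := Set.ncard_add_ncard_compl S
  rw [Nat.card_eq_fintype_card] at h2
  have h3 : (Fintype.card V : ℝ) = S.ncard + Sᶜ.ncard := by exact_mod_cast h2.symm
  have h4 : (S.ncard : ℝ) ≤ G.countDegree 0 S := Nat.cast_le.2 h1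
  linarith

/-- Up to a reflection, the degree counts are bounded by the number of unvisited vertices. -/
theorem abs_countDegree_sub_le (G : Graph V β) (i : ℕ) (S : Set V) :
    |G.countDegree i S - if i = 0 then (Fintype.card V : ℝ) else 0| ≤ Sᶜ.ncard := by
  split_ifs with h
  · subst h
    rw [abs_sub_comm, abs_of_nonneg (sub_nonneg.2 (G.countDegree_le 0 S))]
    exact G.card_sub_countDegree_zero_le S
  · rw [sub_zero, abs_of_nonneg (G.countDegree_nonneg i S)]
    exact G.countDegree_le_ncard_compl h S

end Graph

/-! ### Discretisation of the random walk -/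

namespace VisitedChain

variable {V : Type*} [Fintype V]

/-- The law of the visited set of a Markov chain as a sum over the paths. -/
theorem sum_paths_eq (Q : Matrix V V ℝ) (g : Set V → ℝ) (m : ℕ) (a : V → ℝ) (S : Set V) :
    ∑ y : Fin (m + 1) → V, a (y 0) * (∏ j : Fin m, Q (y j.castSucc) (y j.succ)) *
      g (S ∪ Set.range y) = ∑ x, a x * expect Q g m (insert x S) x := by
  induction m generalizing a S with
  | zero =>
    refine Fintype.sum_equiv (Equiv.funUnique (Fin 1) V) _ _ fun y => ?_
    simp [expect_zero, Set.range_unique, Set.union_comm S]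
  | succ m ih =>
    rw [← (Fin.consEquiv fun _ => V).sum_comp, Fintype.sum_prod_type]
    refine Finset.sum_congr rfl fun x _ => ?_
    -- The induction is over all initial weights so that the row `Q x` can serve as the weight of
    -- the remaining path.
    rw [expect_succ, ← ih (Q x) (insert x S), Finset.mul_sum]
    refine Finset.sum_congr rfl fun y _ => ?_
    simp only [Fin.consEquiv, Equiv.coe_fn_mk, Fin.prod_univ_succ, Fin.cons_zero, Fin.cons_succ,
      Fin.castSucc_zero, ← Fin.succ_castSucc, Fin.range_cons, Set.union_insert, Set.insert_union]
    ring

end VisitedChain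

namespace Graph

/-- The set of vertices visited up to time `T`. -/
def visited {V Ω : Type*} (X : ℝ≥0 → Ω → V) (T : ℝ≥0) (ω : Ω) : Set V :=
  (fun t => X t ω) '' Set.Iic T

/-- The set of vertices visited at the multiples of `T / m` up to time `T`. -/
def gridVisited {V Ω : Type*} (X : ℝ≥0 → Ω → V) (T : ℝ≥0) (m : ℕ) (ω : Ω) : Set V :=
  Set.range fun j : Fin (m + 1) => X (j * (T / m)) ω

variable {V β : Type*} [Fintype V] {G : Graph V β} {Ω : Type*} [MeasurableSpace Ω]
  {P : Measure Ω} {X : ℝ≥0 → Ω → V}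

/-- Reduces integrals over grid paths to finite-dimensional probabilities. -/
theorem comp_eq_sum_indicator {V Ω ι : Type*} [Fintype V] [Fintype ι] [DecidableEq ι]
    (Y : ι → Ω → V) (g : (ι → V) → ℝ) :
    (fun ω => g fun j => Y j ω) =
      fun ω => ∑ y : ι → V, Set.indicator {ω | ∀ j, Y j ω = y j} (fun _ => g y) ω := by
  ext ω
  rw [Finset.sum_eq_single fun j => Y j ω]
  · simp
  · intro y _ hy
    refine Set.indicator_of_notMem (fun h => hy ?_) _
    exact (funext h).symm
  · simp

theorem exists_norm_le_of_finite {V : Type*} [Finite V] (g : Set V → ℝ) : ∃ C, ∀ S, ‖g S‖ ≤ C := by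
  obtain ⟨C, hC⟩ := (Set.finite_range fun S => ‖g S‖).bddAbove
  exact ⟨C, fun S => hC ⟨S, rfl⟩⟩

section Walk

variable (hX : G.IsRandomWalk P X)
include hX

/-- A right-continuous path is seen entirely by a fine enough grid. -/
theorem IsRandomWalk.eventually_gridVisited_eq (T : ℝ≥0) (ω : Ω) :
    ∀ᶠ m in atTop, gridVisited X T m ω = visited X T ω := by
  have hsub : ∀ m : ℕ, m ≠ 0 → gridVisited X T m ω ⊆ visited X T ω := by
    rintro m hm _ ⟨j, rfl⟩
    refine ⟨j * (T / m), ?_, rfl⟩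
    rw [Set.mem_Iic]
    have h1 : ((j : ℕ) : ℝ≥0) ≤ m := Nat.cast_le.2 (Nat.lt_succ_iff.1 j.2)
    calc ((j : ℕ) : ℝ≥0) * (T / m) ≤ m * (T / m) := mul_le_mul_left h1 _
      _ = T := mul_div_cancel₀ T (Nat.cast_ne_zero.2 hm)
  have hsup : ∀ x ∈ visited X T ω, ∀ᶠ m : ℕ in atTop, x ∈ gridVisited X T m ω := by
    rintro _ ⟨t, ht, rfl⟩
    rw [Set.mem_Iic] at ht
    obtain ⟨η, hη, hη'⟩ := (mem_nhdsGE_iff_exists_Ico_subset' (lt_add_one t)).1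
      (hX.right_continuous ω t)
    rcases eq_or_ne T 0 with rfl | hT
    · have : t = 0 := le_antisymm ht bot_le
      subst this
      exact Eventually.of_forall fun m => ⟨0, by simp⟩
    have hlim : Tendsto (fun m : ℕ => T / (m : ℝ≥0)) atTop (𝓝 0) :=
      tendsto_const_div_atTop_nhds_zero_nat T
    have hev := hlim.eventually (gt_mem_nhds (tsub_pos_of_lt hη))
    filter_upwards [hev, eventually_ne_atTop 0] with m hm hm0
    have hm0' : (m : ℝ≥0) ≠ 0 := Nat.cast_ne_zero.2 hm0
    have hδ : 0 < T / m := div_pos (pos_iff_ne_zero.2 hT) (pos_iff_ne_zero.2 hm0')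
    -- The first grid point at or after `t` still belongs to the grid, as `t ≤ T`, and for fine
    -- meshes it lies in the interval where the path is constant.
    have hk : ⌈t / (T / m)⌉₊ ≤ m := by
      refine Nat.ceil_le.2 ?_
      rw [div_le_iff₀ hδ, mul_div_cancel₀ T hm0']
      exact ht
    refine ⟨⟨⌈t / (T / m)⌉₊, Nat.lt_succ_of_le hk⟩, hη' ⟨?_, ?_⟩⟩
    · change t ≤ (⌈t / (T / m)⌉₊ : ℝ≥0) * (T / m)
      rw [← div_le_iff₀ hδ]
      exact Nat.le_ceil _
    · change (⌈t / (T / m)⌉₊ : ℝ≥0) * (T / m) < η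
      calc (⌈t / (T / m)⌉₊ : ℝ≥0) * (T / m) < (t / (T / m) + 1) * (T / m) :=
            mul_lt_mul_of_pos_right (Nat.ceil_lt_add_one bot_le) hδ
        _ = t + T / m := by rw [add_mul, one_mul, div_mul_cancel₀ _ hδ.ne']
        _ < η := by rw [add_comm]; exact lt_tsub_iff_right.1 hm
  have hall : ∀ᶠ m : ℕ in atTop, ∀ x, x ∈ visited X T ω → x ∈ gridVisited X T m ω := by
    rw [eventually_all]
    intro x
    by_cases hx : x ∈ visited X T ω
    · filter_upwards [hsup x hx] with m hm _ using hm
    · exact Eventually.of_forall fun m h => absurd h hx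
  filter_upwards [hall, eventually_ne_atTop 0] with m hm hm0
  exact Set.Subset.antisymm (hsub m hm0) hm

theorem IsRandomWalk.measurableSet_grid (m : ℕ) (h : ℝ≥0) (y : Fin (m + 1) → V) :
    MeasurableSet {ω | ∀ j : Fin (m + 1), X (j * h) ω = y j} := by
  rw [Set.ofPred_forall]
  exact MeasurableSet.iInter fun j => hX.measurableSet_eq _ _

variable [IsProbabilityMeasure P]

theorem IsRandomWalk.integrable_gridVisited (T : ℝ≥0) (m : ℕ) (g : Set V → ℝ) :
    Integrable (fun ω => g (gridVisited X T m ω)) P := by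
  classical
  have := comp_eq_sum_indicator (fun (j : Fin (m + 1)) ω => X (j * (T / m)) ω)
    fun y => g (Set.range y)
  unfold gridVisited
  rw [this]
  exact integrable_finsetSum _ fun y _ =>
    (integrable_const _).indicator (hX.measurableSet_grid m _ y)

theorem IsRandomWalk.integral_gridVisited (T : ℝ≥0) (m : ℕ) (g : Set V → ℝ) :
    ∫ ω, g (gridVisited X T m ω) ∂P =
      ∑ x, unif V * VisitedChain.expect (Matrix.of (G.heatKernel (T / m))) g m {x} x := by
  classical
  have h1 := comp_eq_sum_indicator (fun (j : Fin (m + 1)) ω => X (j * (T / m)) ω)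
    fun y => g (Set.range y)
  have h2 := VisitedChain.sum_paths_eq (Matrix.of (G.heatKernel (T / m))) g m (fun _ => unif V) ∅
  simp only [insert_empty_eq, Set.empty_union] at h2
  unfold gridVisited
  rw [h1, integral_finsetSum _ fun y _ =>
    (integrable_const _).indicator (hX.measurableSet_grid m _ y), ← h2]
  refine Finset.sum_congr rfl fun y _ => ?_
  rw [integral_indicator_const _ (hX.measurableSet_grid m _ y), smul_eq_mul,
    hX.finite_dim m (fun j => j * (T / m)) y
      (fun i j hij => mul_le_mul_left (Nat.cast_le.2 hij) _) (by simp)]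
  congr 2
  refine Finset.prod_congr rfl fun j _ => ?_
  have : ((j.succ : Fin (m + 1)) : ℕ) * (T / m) - ((j.castSucc : Fin (m + 1)) : ℕ) * (T / m) =
      T / m := by
    rw [Fin.val_succ, Fin.val_castSucc, Nat.cast_add, Nat.cast_one, add_mul, one_mul,
      add_tsub_cancel_left]
  rw [this]
  rfl

theorem IsRandomWalk.aestronglyMeasurable_visited (T : ℝ≥0) (g : Set V → ℝ) :
    AEStronglyMeasurable (fun ω => g (visited X T ω)) P :=
  aestronglyMeasurable_of_tendsto_ae atTop
    (fun m => (hX.integrable_gridVisited T m g).aestronglyMeasurable)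
    (Eventually.of_forall fun ω => tendsto_const_nhds.congr'
      ((hX.eventually_gridVisited_eq T ω).mono fun _ hm => congrArg g hm.symm))

theorem IsRandomWalk.integrable_visited (T : ℝ≥0) (g : Set V → ℝ) :
    Integrable (fun ω => g (visited X T ω)) P := by
  obtain ⟨C, hC⟩ := exists_norm_le_of_finite g
  exact Integrable.of_bound (hX.aestronglyMeasurable_visited T g) C
    (Eventually.of_forall fun ω => hC _)

/-- Dominated convergence carries bounds uniform in the mesh over to continuous time; `g` is
bounded, having finitely many arguments. -/
theorem IsRandomWalk.tendsto_sum_expect (T : ℝ≥0) (g : Set V → ℝ) :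
    Tendsto (fun m : ℕ => ∑ x, unif V *
      VisitedChain.expect (Matrix.of (G.heatKernel (T / m))) g m {x} x) atTop
      (𝓝 (∫ ω, g (visited X T ω) ∂P)) := by
  obtain ⟨C, hC⟩ := exists_norm_le_of_finite g
  simp_rw [← hX.integral_gridVisited]
  exact tendsto_integral_of_dominated_convergence (fun _ => C)
    (fun m => (hX.integrable_gridVisited T m g).aestronglyMeasurable) (integrable_const _)
    (fun m => Eventually.of_forall fun ω => hC _)
    (Eventually.of_forall fun ω => tendsto_const_nhds.congr'
      ((hX.eventually_gridVisited_eq T ω).mono fun _ hm => congrArg g hm.symm))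

variable [Nonempty V] {d : ℕ} (hG : G.IsRegularMultigraph d) {α : ℝ} (hα0 : 0 < α)
  (hα : (α : EReal) ≤ G.spectralGap)
include hG hα0 hα

/-- The exponential moments of a Lipschitz function of the visited set. -/
theorem IsRandomWalk.integral_exp_le {φ : Set V → ℝ} {L : ℝ}
    (hφ : ∀ z S, |φ (insert z S) - φ S| ≤ L) (hφ' : ∀ S, |φ S| ≤ Fintype.card V) {τ B θ : ℝ}
    (hτ : 0 ≤ τ) (hB : 2 * L * (2 + τ) + 2 * (Real.exp (-α * τ) * (Fintype.card V : ℝ) ^ 2) ≤ B)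
    (hθ : 0 ≤ θ) (hθB : θ * B ≤ 1) (T : ℝ≥0) :
    ∫ ω, Real.exp (θ * φ (visited X T ω)) ∂P ≤
      Real.exp (θ * ∫ ω, φ (visited X T ω) ∂P + θ ^ 2 * B ^ 2 * (1 + T)) := by
  classical
  have hL : 0 ≤ L := (abs_nonneg _).trans (hφ (Classical.arbitrary V) ∅)
  have hlim1 := hX.tendsto_sum_expect T fun S => Real.exp (θ * φ S)
  have hlim2 := hX.tendsto_sum_expect T φ
  have hlim3 := (Real.continuous_exp.tendsto _).comp
    ((hlim2.const_mul θ).add_const (θ ^ 2 * B ^ 2 * (1 + T)))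
  refine le_of_tendsto_of_tendsto hlim1 hlim3 ?_
  have hδlim : Tendsto (fun m : ℕ => (T : ℝ) / m) atTop (𝓝 0) :=
    tendsto_const_div_atTop_nhds_zero_nat _
  filter_upwards [hδlim.eventually (gt_mem_nhds one_pos), eventually_ne_atTop 0] with m hm hm0
  have hQ := hG.isContractive_heatKernel hα (T / m)
  set δ : ℝ := ((T / m : ℝ≥0) : ℝ)
  have hδ : δ = T / m := by simp [δ]
  have hδ0 : 0 ≤ δ := NNReal.coe_nonneg _
  have hosc : ∀ j ≤ m, ∀ S x y,
      |VisitedChain.expect (Matrix.of (G.heatKernel (T / m))) φ j (insert x S) x -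
        VisitedChain.expect (Matrix.of (G.heatKernel (T / m))) φ j (insert y S) y| ≤ B := by
    intro j _ S x y
    have he : 0 ≤ Real.exp (-α * τ) * (Fintype.card V : ℝ) ^ 2 := by positivity
    -- With little time left the trivial bound suffices; otherwise mix for `⌈τ / δ⌉₊` steps, a time
    -- between `τ` and `τ + 1` because `δ < 1`.
    by_cases hj : j * δ ≤ τ + 1
    · refine (hQ.abs_expect_sub_expect_le hφ j S x y).trans (le_trans ?_ hB)
      have := mul_le_mul_of_nonneg_left (show 1 + j * δ ≤ 2 + τ by linarith)
        (show 0 ≤ 2 * L by positivity)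
      linarith
    · have hδ' : 0 < δ := by
        rcases hδ0.eq_or_lt with h | h
        · rw [← h] at hj
          exact absurd (by linarith) hj
        · exact h
      set s : ℕ := ⌈τ / δ⌉₊
      have hs1 : τ ≤ s * δ := by
        rw [← div_le_iff₀ hδ']; exact Nat.le_ceil _
      have hs2 : s * δ ≤ τ + 1 := by
        have := mul_le_mul_of_nonneg_right (Nat.ceil_lt_add_one (div_nonneg hτ hδ0)).le hδ0
        rw [add_mul, div_mul_cancel₀ _ hδ'.ne'] at this
        have hδ1 : δ < 1 := hδ ▸ hm
        linarith
      have hsj : s ≤ j := by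
        have : (s : ℝ) < j := lt_of_mul_lt_mul_right (hs2.trans_lt (not_le.1 hj)) hδ0
        exact_mod_cast this.le
      refine (hQ.abs_expect_sub_expect_le_of_mixing hφ hφ' hsj S x y).trans (le_trans ?_ hB)
      have h1 : Real.exp (-α * δ) ^ s ≤ Real.exp (-α * τ) := by
        rw [← Real.exp_nat_mul, Real.exp_le_exp]
        nlinarith
      have h2 := mul_le_mul_of_nonneg_right h1 (sq_nonneg (Fintype.card V : ℝ))
      have h3 := mul_le_mul_of_nonneg_left (show 1 + s * δ ≤ 2 + τ by linarith)
        (show 0 ≤ 2 * L by positivity)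
      linarith
  have := hQ.sum_expect_exp_le hθ hθB hosc
  have hmδ : m * δ = T := by
    rw [hδ]; exact mul_div_cancel₀ _ (Nat.cast_ne_zero.2 hm0)
  rw [hmδ] at this
  exact this

open Classical in
/-- The probability that a set of vertices is avoided. -/
theorem IsRandomWalk.integral_avoid_le (A : Finset V) (T : ℝ≥0) :
    ∫ ω, (if Disjoint (A : Set V) (visited X T ω) then 1 else 0 : ℝ) ∂P ≤
      Real.exp (-(A.card / Fintype.card V * (α * T) / 2)) := by
  set n : ℝ := ((Fintype.card V : ℕ) : ℝ)
  have hlim := hX.tendsto_sum_expect T fun S => if Disjoint (A : Set V) S then (1 : ℝ) else 0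
  refine le_of_tendsto hlim ?_
  have hδlim : Tendsto (fun m : ℕ => (2 * α * T) / m) atTop (𝓝 0) :=
    tendsto_const_div_atTop_nhds_zero_nat _
  filter_upwards [hδlim.eventually (gt_mem_nhds one_pos), eventually_ne_atTop 0] with m hm hm0
  have hQ := hG.isContractive_heatKernel hα (T / m)
  have hρ : Real.exp (-α * (T / m : ℝ≥0)) ≤ 1 :=
    Real.exp_le_one_iff.2 (mul_nonpos_of_nonpos_of_nonneg (by linarith) (NNReal.coe_nonneg _))
  have h1 := hQ.sum_expect_avoid_sq_le hρ A m
  -- The available bound is for the square of the probability, hence the factor `1 / 2` in the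
  -- exponent.
  refine le_of_abs_le (abs_le_of_sq_le_sq (h1.trans ?_) (Real.exp_pos _).le)
  set b : ℝ := A.card / n
  have hb : 0 ≤ b := by positivity
  have hb1 : b ≤ 1 := div_le_one_of_le₀ (Nat.cast_le.2 (Finset.card_le_univ A)) (Nat.cast_nonneg _)
  set x : ℝ := 2 * α * T / m
  have hx0 : 0 ≤ x := by positivity
  have hmx : m * x = 2 * (α * T) := by
    simp only [x]
    field_simp
  have hρ2 : Real.exp (-α * (T / m : ℝ≥0)) ^ 2 = Real.exp (-x) := by
    rw [← Real.exp_nat_mul]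
    congr 1
    push_cast
    simp only [x]
    ring
  have hx : Real.exp (-x) ≤ 1 - x / 2 := by
    have h2 := Real.add_one_le_exp x
    have h3 : Real.exp (-x) * Real.exp x = 1 := by rw [← Real.exp_add]; simp
    have h4 : Real.exp (-x) * (x + 1) ≤ 1 :=
      (mul_le_mul_of_nonneg_left h2 (Real.exp_pos _).le).trans_eq h3
    nlinarith [Real.exp_pos (-x)]
  rw [hρ2]
  have h2 : 1 - b * (1 - Real.exp (-x)) ≤ Real.exp (-(b * x / 2)) := by
    have h3 := Real.add_one_le_exp (-(b * x / 2))
    have h4 := mul_le_mul_of_nonneg_left hx hb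
    linarith
  have h3 : 0 ≤ 1 - b * (1 - Real.exp (-x)) := by
    have h4 := Real.exp_pos (-x)
    have h5 : b * (1 - Real.exp (-x)) ≤ 1 * 1 :=
      mul_le_mul hb1 (by linarith) (by linarith) zero_le_one
    linarith
  calc _ ≤ Real.exp (-(b * x / 2)) ^ m := pow_le_pow_left₀ h3 h2 m
    _ = Real.exp (-(b * (m * x) / 2)) := by
        rw [← Real.exp_nat_mul]
        ring_nf
    _ = _ := by
        rw [hmx, ← Real.exp_nat_mul]
        push_cast
        ring_nf

end Walk

end Graph

/-! ### Concentration -/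

namespace Graph

section Tails

variable {V β : Type*} [Fintype V] {G : Graph V β} {Ω : Type*} [MeasurableSpace Ω]
  {P : Measure Ω} {X : ℝ≥0 → Ω → V} (hX : G.IsRandomWalk P X) [IsProbabilityMeasure P]
  [Nonempty V] {d : ℕ} (hG : G.IsRegularMultigraph d) {α : ℝ} (hα0 : 0 < α)
  (hα : (α : EReal) ≤ G.spectralGap)
include hX hG hα0 hα

theorem IsRandomWalk.upper_tail_le {φ : Set V → ℝ} {L : ℝ}
    (hφ : ∀ z S, |φ (insert z S) - φ S| ≤ L) (hφ' : ∀ S, |φ S| ≤ Fintype.card V) {τ B θ : ℝ}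
    (hτ : 0 ≤ τ) (hB : 2 * L * (2 + τ) + 2 * (Real.exp (-α * τ) * (Fintype.card V : ℝ) ^ 2) ≤ B)
    (hθ : 0 ≤ θ) (hθB : θ * B ≤ 1) (T : ℝ≥0) (a : ℝ) :
    P.real {ω | a ≤ φ (visited X T ω) - ∫ ω', φ (visited X T ω') ∂P} ≤
      Real.exp (-(θ * a) + θ ^ 2 * B ^ 2 * (1 + T)) := by
  set E : ℝ := ∫ ω', φ (visited X T ω') ∂P
  have h1 := ProbabilityTheory.measure_ge_le_exp_mul_mgf (μ := P)
    (X := fun ω => φ (visited X T ω)) (E + a) hθ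
    (hX.integrable_visited T fun S => Real.exp (θ * φ S))
  have h2 := hX.integral_exp_le hG hα0 hα hφ hφ' hτ hB hθ hθB T
  have h3 : {ω | a ≤ φ (visited X T ω) - E} = {ω | E + a ≤ φ (visited X T ω)} := by
    ext ω
    exact le_sub_iff_add_le' (α := ℝ)
  rw [h3]
  calc _ ≤ _ := h1
    _ ≤ Real.exp (-θ * (E + a)) * Real.exp (θ * E + θ ^ 2 * B ^ 2 * (1 + T)) :=
        mul_le_mul_of_nonneg_left h2 (Real.exp_pos _).le
    _ = _ := by rw [← Real.exp_add]; ring_nf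

theorem IsRandomWalk.two_sided_tail_le {φ : Set V → ℝ} {L : ℝ}
    (hφ : ∀ z S, |φ (insert z S) - φ S| ≤ L) (hφ' : ∀ S, |φ S| ≤ Fintype.card V) {τ B θ : ℝ}
    (hτ : 0 ≤ τ) (hB : 2 * L * (2 + τ) + 2 * (Real.exp (-α * τ) * (Fintype.card V : ℝ) ^ 2) ≤ B)
    (hθ : 0 ≤ θ) (hθB : θ * B ≤ 1) (T : ℝ≥0) (a : ℝ) :
    P.real {ω | a ≤ |φ (visited X T ω) - ∫ ω', φ (visited X T ω') ∂P|} ≤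
      2 * Real.exp (-(θ * a) + θ ^ 2 * B ^ 2 * (1 + T)) := by
  have h1 := hX.upper_tail_le hG hα0 hα hφ hφ' hτ hB hθ hθB T a
  have h2 := hX.upper_tail_le hG hα0 hα (φ := fun S => -φ S)
    (fun z S => by rw [neg_sub_neg, abs_sub_comm]; exact hφ z S)
    (fun S => by rw [abs_neg]; exact hφ' S) hτ hB hθ hθB T a
  rw [integral_neg] at h2
  have h3 : {ω | a ≤ |φ (visited X T ω) - ∫ ω', φ (visited X T ω') ∂P|} ⊆
      {ω | a ≤ φ (visited X T ω) - ∫ ω', φ (visited X T ω') ∂P} ∪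
      {ω | a ≤ -φ (visited X T ω) - -∫ ω', φ (visited X T ω') ∂P} := by
    intro ω hω
    rcases le_abs.1 (show a ≤ |_| from hω) with h | h
    · exact Or.inl h
    · refine Or.inr (show a ≤ _ from ?_)
      linarith
  have h4 := (measureReal_mono h3 (measure_ne_top P _)).trans (measureReal_union_le _ _)
  linarith

/-- The probability that at least `k` vertices are unvisited. -/
theorem IsRandomWalk.measure_le_ncard_compl_visited_le (T : ℝ≥0) (k : ℕ) :
    P.real {ω | k ≤ (visited X T ω)ᶜ.ncard} ≤
      (Fintype.card V * Real.exp (-(α * T / (2 * Fintype.card V)))) ^ k := by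
  classical
  -- The number of unvisited `k`-sets; it is at least one as soon as `k` vertices are unvisited, so
  -- Markov's inequality applies.
  set g : Set V → ℝ := fun S => ∑ A ∈ Finset.powersetCard k (Finset.univ : Finset V),
    if Disjoint (A : Set V) S then 1 else 0
  have hg0 : ∀ S, 0 ≤ g S := fun S => Finset.sum_nonneg fun A _ => by positivity
  have h1 := mul_meas_ge_le_integral_of_nonneg (Eventually.of_forall fun ω => hg0 (visited X T ω))
    (hX.integrable_visited T g) 1
  rw [one_mul] at h1
  have h2 : {ω | k ≤ (visited X T ω)ᶜ.ncard} ⊆ {ω | 1 ≤ g (visited X T ω)} := by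
    intro ω hω
    have hω' : k ≤ (visited X T ω)ᶜ.toFinset.card := by
      rwa [← Set.ncard_eq_toFinset_card']
    obtain ⟨A, hA, hAk⟩ := Finset.exists_subset_card_eq hω'
    have hd : Disjoint (A : Set V) (visited X T ω) := by
      rw [← Set.subset_compl_iff_disjoint_right]
      intro x hx
      simpa using hA hx
    have := Finset.single_le_sum (f := fun A : Finset V =>
      if Disjoint (A : Set V) (visited X T ω) then (1 : ℝ) else 0)
      (fun A _ => by positivity) (Finset.mem_powersetCard.2 ⟨Finset.subset_univ A, hAk⟩)
    exact (if_pos hd).symm.trans_le this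
  have h3 : ∫ ω, g (visited X T ω) ∂P ≤
      ∑ A ∈ Finset.powersetCard k (Finset.univ : Finset V),
        Real.exp (-(α * T / (2 * Fintype.card V))) ^ k := by
    simp only [g]
    have hint (A : Finset V) := hX.integrable_visited T fun S =>
      if Disjoint (A : Set V) S then (1 : ℝ) else 0
    rw [integral_finsetSum _ fun A _ => hint A]
    refine Finset.sum_le_sum fun A hA => (hX.integral_avoid_le hG hα0 hα A T).trans_eq ?_
    rw [← Real.exp_nat_mul, (Finset.mem_powersetCard.1 hA).2]
    congr 1
    field_simp
  rw [Finset.sum_const, Finset.card_powersetCard, Finset.card_univ, nsmul_eq_mul] at h3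
  have h4 : ((Fintype.card V).choose k : ℝ) ≤ (Fintype.card V : ℝ) ^ k := by
    exact_mod_cast Nat.choose_le_pow _ _
  calc _ ≤ _ := measureReal_mono h2 (measure_ne_top P _)
    _ ≤ _ := h1
    _ ≤ _ := h3
    _ ≤ _ := mul_le_mul_of_nonneg_right h4 (by positivity)
    _ = _ := (mul_pow _ _ _).symm

theorem IsRandomWalk.integral_ncard_compl_visited_le (T : ℝ≥0) :
    ∫ ω, ((visited X T ω)ᶜ.ncard : ℝ) ∂P ≤
      Fintype.card V * Real.exp (-(α * T / (2 * Fintype.card V))) := by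
  classical
  have h1 : ∀ S : Set V, (Sᶜ.ncard : ℝ) =
      ∑ x, if Disjoint (({x} : Finset V) : Set V) S then (1 : ℝ) else 0 := by
    intro S
    rw [Set.ncard_eq_toFinset_card', Finset.sum_boole]
    congr 2
    ext x
    simp
  simp_rw [h1]
  rw [integral_finsetSum _ fun x _ => hX.integrable_visited T fun S =>
      if Disjoint (({x} : Finset V) : Set V) S then (1 : ℝ) else 0]
  calc _ ≤ ∑ _x : V, Real.exp (-(α * T / (2 * Fintype.card V))) := by
        refine Finset.sum_le_sum fun x _ => (hX.integral_avoid_le hG hα0 hα {x} T).trans_eq ?_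
        rw [Finset.card_singleton]
        congr 1
        push_cast
        field_simp
    _ = _ := by rw [Finset.sum_const, Finset.card_univ, nsmul_eq_mul]

/-- A function bounded, up to a constant, by the number of unvisited vertices is concentrated at
large times. -/
theorem IsRandomWalk.tail_le_of_large_time {φ : Set V → ℝ} {c₀ : ℝ}
    (hφ : ∀ S, |φ S - c₀| ≤ Sᶜ.ncard) {T : ℝ≥0}
    (hT : Fintype.card V * Real.exp (-(α * T / (2 * Fintype.card V))) ≤ Real.exp (-1)) (a : ℝ) :
    P.real {ω | a ≤ |φ (visited X T ω) - ∫ ω', φ (visited X T ω') ∂P|} ≤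
      Real.exp (-(a - 1)) := by
  set E : ℝ := ∫ ω', φ (visited X T ω') ∂P
  -- The mean is within `1` of `c₀`, so a deviation `a` forces at least `a - 1` unvisited vertices.
  have hE : |E - c₀| ≤ 1 := by
    have h1 : E - c₀ = ∫ ω, (φ (visited X T ω) - c₀) ∂P := by
      rw [integral_sub (hX.integrable_visited T φ) (integrable_const _)]
      simp [E]
    rw [h1]
    calc _ ≤ ∫ ω, |φ (visited X T ω) - c₀| ∂P := abs_integral_le_integral_abs
      _ ≤ ∫ ω, ((visited X T ω)ᶜ.ncard : ℝ) ∂P :=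
          integral_mono (hX.integrable_visited T fun S => |φ S - c₀|)
            (hX.integrable_visited T fun S => (Sᶜ.ncard : ℝ)) fun ω => hφ _
      _ ≤ _ := hX.integral_ncard_compl_visited_le hG hα0 hα T
      _ ≤ Real.exp (-1) := hT
      _ ≤ 1 := Real.exp_le_one_iff.2 (by norm_num)
  have hsub : {ω | a ≤ |φ (visited X T ω) - E|} ⊆
      {ω | ⌈a - 1⌉₊ ≤ (visited X T ω)ᶜ.ncard} := by
    intro ω hω
    have h1 : a ≤ |φ (visited X T ω) - E| := hω
    have h2 := abs_sub_le (φ (visited X T ω)) c₀ E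
    rw [abs_sub_comm c₀] at h2
    have h3 := hφ (visited X T ω)
    exact Nat.ceil_le.2 (by linarith)
  calc _ ≤ _ := measureReal_mono hsub (measure_ne_top P _)
    _ ≤ _ := hX.measure_le_ncard_compl_visited_le hG hα0 hα T _
    _ ≤ Real.exp (-1) ^ ⌈a - 1⌉₊ := pow_le_pow_left₀ (by positivity) hT _
    _ = Real.exp (-(⌈a - 1⌉₊ : ℝ)) := by rw [← Real.exp_nat_mul]; ring_nf
    _ ≤ _ := Real.exp_le_exp.2 (neg_le_neg (Nat.le_ceil _))

end Tails

/-- The numerical inequalities that hold for a large number of vertices. -/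
theorem eventually_concentration_bounds {α ε K : ℝ} (hα : 0 < α) (hε : 0 < ε) (hε' : ε < 1 / 4) :
    ∀ᶠ x : ℝ in atTop, 1 ≤ x ∧ x ^ ε + 1 ≤ x ^ (1 / 2 + ε) ∧
      x * Real.exp (-(α / 2) * x ^ (ε / 8)) ≤ Real.exp (-1) ∧
      2 * K ≤ x ^ (1 / 2 - ε / 8) ∧ 8 * K ^ 2 ≤ x ^ (5 * (ε / 8)) := by
  have h1 : Tendsto (fun x : ℝ => x * Real.exp (-(α / 2) * x ^ (ε / 8))) atTop (𝓝 0) := by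
    -- Substitute `y = x ^ (ε / 8)`, so that `x = y ^ (8 / ε)`.
    have h2 := (tendsto_rpow_mul_exp_neg_mul_atTop_nhds_zero (8 / ε) (α / 2) (by positivity)).comp
      (tendsto_rpow_atTop (show 0 < ε / 8 by positivity))
    refine h2.congr' ?_
    filter_upwards [eventually_ge_atTop 0] with x hx
    simp only [Function.comp]
    rw [← Real.rpow_mul hx, show ε / 8 * (8 / ε) = 1 by field_simp, Real.rpow_one]
  filter_upwards [eventually_ge_atTop 4, h1.eventually (ge_mem_nhds (Real.exp_pos (-1))),
    (tendsto_rpow_atTop (show 0 < 1 / 2 - ε / 8 by linarith)).eventually_ge_atTop (2 * K),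
    (tendsto_rpow_atTop (show 0 < 5 * (ε / 8) by linarith)).eventually_ge_atTop (8 * K ^ 2)]
    with x hx h2 h3 h4
  refine ⟨by linarith, ?_, h2, h3, h4⟩
  have h5 : (2 : ℝ) ≤ x ^ (1 / 2 : ℝ) := by
    rw [← Real.sqrt_eq_rpow]
    exact Real.le_sqrt_of_sq_le (by linarith)
  have h6 : 1 ≤ x ^ ε := Real.one_le_rpow (by linarith) hε.le
  rw [Real.rpow_add (by linarith)]
  nlinarith

theorem IsRandomWalk.countDegree_tail_le {V β : Type*} [Fintype V] {G : Graph V β} {Ω : Type*}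
    [MeasurableSpace Ω] {P : Measure Ω} {X : ℝ≥0 → Ω → V} (hX : G.IsRandomWalk P X)
    [IsProbabilityMeasure P] [Nonempty V] {d : ℕ} (hG : G.IsRegularMultigraph d) {α : ℝ}
    (hα0 : 0 < α) (hα : (α : EReal) ≤ G.spectralGap) {ε x K : ℝ} (hx : Fintype.card V = x)
    (hε : 0 < ε) (hK : K = 7 * (d + 1)) (h1 : 1 ≤ x)
    (h2 : x ^ ε + 1 ≤ x ^ (1 / 2 + ε))
    (h3 : x * Real.exp (-(α / 2) * x ^ (ε / 8)) ≤ Real.exp (-1))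
    (h4 : 2 * K ≤ x ^ (1 / 2 - ε / 8)) (h5 : 8 * K ^ 2 ≤ x ^ (5 * (ε / 8))) (i : ℕ) (u : ℝ≥0) :
    P.real {ω | x ^ (1 / 2 + ε) ≤ |G.countDegree i (visited X (u * (Fintype.card V : ℝ≥0)) ω) -
      ∫ ω', G.countDegree i (visited X (u * (Fintype.card V : ℝ≥0)) ω') ∂P|} ≤
      2 * Real.exp (-x ^ ε) := by
  have hx0 : 0 < x := by linarith
  set T : ℝ≥0 := u * (Fintype.card V : ℝ≥0)
  have hT : (T : ℝ) = u * x := by simp [T, hx]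
  rcases le_total (u : ℝ) (x ^ (ε / 8)) with hu | hu
  · set τ : ℝ := x ^ (ε / 8)
    have hτ1 : 1 ≤ τ := Real.one_le_rpow h1 (by positivity)
    -- The linear term is then `2 x ^ ε`, while the quadratic one is at most `8 K² x ^ (3 ε / 8) ≤ x
    -- ^ ε`.
    set θ : ℝ := 2 * x ^ (-(1 / 2) : ℝ)
    -- As `τ ≥ 1`, the first term is at most `6 (d + 1) τ` and the mixing error at most `1`: hence
    -- the `7` in `K`.
    have hB : 2 * ((d : ℝ) + 1) * (2 + τ) +
        2 * (Real.exp (-α * τ) * (Fintype.card V : ℝ) ^ 2) ≤ K * τ := by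
      have h6 : Real.exp (-α * τ) * (Fintype.card V : ℝ) ^ 2 =
          (x * Real.exp (-(α / 2) * τ)) ^ 2 := by
        rw [hx, mul_pow, ← Real.exp_nat_mul, mul_comm]
        push_cast
        ring_nf
      have h7 : (x * Real.exp (-(α / 2) * τ)) ^ 2 ≤ Real.exp (-1) ^ 2 :=
        pow_le_pow_left₀ (by positivity) h3 2
      have h8 : Real.exp (-1) ^ 2 ≤ 1 / 2 := by
        have h9 : Real.exp (-1) ≤ 1 / 2 := by
          rw [Real.exp_neg, one_div]
          exact inv_anti₀ (by norm_num) (by linarith [Real.add_one_le_exp (1 : ℝ)])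
        nlinarith [Real.exp_pos (-1)]
      have h9 : 0 ≤ (d : ℝ) := Nat.cast_nonneg d
      rw [h6, hK]
      nlinarith
    have hθB : θ * (K * τ) ≤ 1 := by
      have h6 : x ^ (-(1 / 2) : ℝ) * τ * x ^ (1 / 2 - ε / 8) = 1 := by
        rw [← Real.rpow_add hx0, ← Real.rpow_add hx0]
        ring_nf
        simp
      calc θ * (K * τ) = x ^ (-(1 / 2) : ℝ) * τ * (2 * K) := by simp only [θ]; ring
        _ ≤ x ^ (-(1 / 2) : ℝ) * τ * x ^ (1 / 2 - ε / 8) :=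
            mul_le_mul_of_nonneg_left h4 (by positivity)
        _ = 1 := h6
    refine (hX.two_sided_tail_le hG hα0 hα (hG.abs_countDegree_insert_sub_le i)
      (fun S => by
        rw [abs_of_nonneg (G.countDegree_nonneg i S)]
        exact G.countDegree_le i S)
      (zero_le_one.trans hτ1) hB (by positivity) hθB T _).trans ?_
    refine mul_le_mul_of_nonneg_left (Real.exp_le_exp.2 ?_) zero_le_two
    have h6 : θ * x ^ (1 / 2 + ε) = 2 * x ^ ε := by
      simp only [θ]
      rw [mul_assoc, ← Real.rpow_add hx0]
      ring_nf
    have h7 : θ ^ 2 * (K * τ) ^ 2 * (1 + T) ≤ x ^ ε := by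
      have h8 : θ ^ 2 * x = 4 := by
        simp only [θ]
        rw [mul_pow, ← Real.rpow_natCast (x ^ (-(1 / 2) : ℝ)), ← Real.rpow_mul hx0.le, mul_assoc]
        norm_num
        rw [Real.rpow_neg_one, inv_mul_cancel₀ hx0.ne']
      have h9 : 1 + (T : ℝ) ≤ 2 * (τ * x) := by
        rw [hT]
        have h10 := mul_le_mul_of_nonneg_right hu hx0.le
        nlinarith
      calc θ ^ 2 * (K * τ) ^ 2 * (1 + T) ≤ θ ^ 2 * (K * τ) ^ 2 * (2 * (τ * x)) :=
            mul_le_mul_of_nonneg_left h9 (by positivity)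
        _ = (θ ^ 2 * x) * 2 * K ^ 2 * τ ^ 3 := by ring
        _ = 8 * K ^ 2 * τ ^ 3 := by rw [h8]; ring
        _ ≤ x ^ (5 * (ε / 8)) * τ ^ 3 := mul_le_mul_of_nonneg_right h5 (by positivity)
        _ = x ^ ε := by
            rw [← Real.rpow_natCast τ, ← Real.rpow_mul hx0.le, ← Real.rpow_add hx0]
            push_cast
            ring_nf
    rw [h6]
    linarith
  · have hT' : Fintype.card V * Real.exp (-(α * T / (2 * Fintype.card V))) ≤ Real.exp (-1) := by
      refine le_trans ?_ h3
      rw [hT, hx]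
      refine mul_le_mul_of_nonneg_left (Real.exp_le_exp.2 ?_) hx0.le
      have h6 : α * (u * x) / (2 * x) = α / 2 * u := by field_simp
      rw [h6]
      nlinarith
    refine (hX.tail_le_of_large_time hG hα0 hα (G.abs_countDegree_sub_le i) hT' _).trans ?_
    have h6 : Real.exp (-(x ^ (1 / 2 + ε) - 1)) ≤ Real.exp (-x ^ ε) :=
      Real.exp_le_exp.2 (by linarith)
    linarith [Real.exp_pos (-x ^ ε)]

end Graph

theorem theorem4p2 (d : ℕ) :
    ∃ c : ℝ, 0 < c ∧ ∀ α : ℝ, 0 < α → ∀ ε : ℝ, 0 < ε → ε < 1 / 4 → ∃ C : ℝ, 0 < C ∧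
      ∀ (n : ℕ) (β : Type*) (G : Graph (Fin n) β),
        G.IsRegularMultigraph d → (α : EReal) ≤ G.spectralGap →
      ∀ (Ω : Type*) [MeasurableSpace Ω] (P : Measure Ω) [IsProbabilityMeasure P]
        (X : ℝ≥0 → Ω → Fin n), G.IsRandomWalk P X →
      ∀ (u : ℝ≥0) (i : ℕ), i ≤ d →
        Integrable
          (fun ω => ((G.vacantGraph (fun t => X t ω) u).numVerticesOfDegree i : ℝ)) P ∧
        P.real {ω | (n : ℝ) ^ (1 / 2 + ε) ≤
            |((G.vacantGraph (fun t => X t ω) u).numVerticesOfDegree i : ℝ) -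
              ∫ ω', ((G.vacantGraph (fun t => X t ω') u).numVerticesOfDegree i : ℝ) ∂P|} ≤
          C * Real.exp (-c * (n : ℝ) ^ ε) := by
  refine ⟨1, one_pos, fun α hα ε hε hε' => ?_⟩
  obtain ⟨n₀, hn₀⟩ := eventually_atTop.1 (tendsto_natCast_atTop_atTop.eventually
    (Graph.eventually_concentration_bounds (K := 7 * ((d : ℝ) + 1)) hα hε hε'))
  -- The `2` comes from the two tails; the exponential makes the bound trivial for `n < n₀`.
  refine ⟨max 2 (Real.exp ((n₀ : ℝ) ^ ε)), by positivity, ?_⟩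
  intro n β G hG hgap Ω _ P _ X hX u i _
  simp_rw [Graph.vacantGraph_eq_avoiding]
  refine ⟨hX.integrable_visited _ (G.countDegree i), ?_⟩
  rw [neg_one_mul]
  rcases lt_or_ge n n₀ with hn | hn
  · refine measureReal_le_one.trans ?_
    have h1 : (n : ℝ) ^ ε ≤ (n₀ : ℝ) ^ ε :=
      Real.rpow_le_rpow (Nat.cast_nonneg n) (Nat.cast_le.2 hn.le) hε.le
    calc (1 : ℝ) ≤ Real.exp ((n₀ : ℝ) ^ ε) * Real.exp (-(n : ℝ) ^ ε) := by
          rw [← Real.exp_add]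
          exact Real.one_le_exp (by linarith)
      _ ≤ _ := mul_le_mul_of_nonneg_right (le_max_right _ _) (Real.exp_pos _).le
  · obtain ⟨h1, h2, h3, h4, h5⟩ := hn₀ n hn
    have : NeZero n := ⟨by rintro rfl; norm_num at h1⟩
    refine (hX.countDegree_tail_le hG hα hgap (by simp) hε rfl h1 h2 h3 h4 h5 i u).trans ?_
    exact mul_le_mul_of_nonneg_right (le_max_left _ _) (Real.exp_pos _).le
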